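/- Let $X$ be an operator space, that is, a complex vector space with a norm on each matrix space $M_n(X)$ such that $\|x\oplus y\|=\max\{\|x\|,\|y\|\}$ and $\|\alpha x\beta\|\le\|\alpha\|\,\|x\|\,\|\beta\|$ for scalar matrices $\alpha,\beta$; rectangular matrices are normed by completing them with zeros to square ones. Write $C_2(X)=M_{2,1}(X)$ and $R_2=M_{1,2}(\mathbb C)$, and let $R_2[X]=R_2\,\hat\otimes\,X$ be the operator space projective tensor product, whose elements $e_1\otimes x+e_2\otimes y$ are written $[x\;\;y]$. The dual $X^*$ carries its standard operator space structure $M_n(X^*)=CB(X,M_n(\mathbb C))$. A linear map $P$ on an operator space $Y$ with $P^2=P$ is a complete left $M$-projection if for every $n$ and every $x\in M_n(Y)$, with $P_n$ acting entrywise, $$\|x\|=\left\|\begin{bmatrix}P_n(x)\\ x-P_n(x)\end{bmatrix}\right\|_{C_2(M_n(Y))},$$ and it is a complete right $L$-projection if the map $Y\to R_2[Y]$, $x\mapsto[\,P(x)\;\;x-P(x)\,]$, is a complete isometry. Let $P:X\to X$ be a linear map with $P^2=P$. Then $P$ is a complete left $M$-projection if and only if $P$ is bounded and its adjoint $P^*:X^*\to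 X^*$ is a complete right $L$-projection. Similarly, $P$ is a complete right $L$-projection if and only if $P$ is bounded and $P^*$ is a complete left $M$-projection. -/

import Mathlib

noncomputable section

namespace OpSp

open scoped TensorProduct Matrix.Norms.L2Operator

open Classical in
/-- The operator norm of a complex `m × n` matrix, acting between the Hilbert spaces
`ℂⁿ` and `ℂᵐ`. -/
def scalarNorm {m n : Type} [Fintype m] [Fintype n] (A : Matrix m n ℂ) : ℝ := ‖A‖

/-- The product `α x β` of a matrix `x` over a vector space with scalar matrices `α`, `β`. -/
def twoSided {X : Type*} [AddCommMonoid X] [Module ℂ X] {m k l n : Type} [Fintype k] [Fintype l]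
    (α : Matrix m k ℂ) (x : Matrix k l X) (β : Matrix l n ℂ) : Matrix m n X :=
  Matrix.of fun i j => ∑ p, ∑ q, (α i p * β q j) • x p q

/-- An (abstract) operator space: a complex vector space with norms on all the matrix spaces
`M_n(X)`, subject to Ruan's two axioms. The norm of `X` itself is the one of `M_1(X)`. -/
class OperatorSpace (X : Type*) [NormedAddCommGroup X] [NormedSpace ℂ X] where
  matNorm : ∀ {n : ℕ}, Matrix (Fin n) (Fin n) X → ℝ
  matNorm_add_le : ∀ {n : ℕ} (x y : Matrix (Fin n) (Fin n) X),
    matNorm (x + y) ≤ matNorm x + matNorm y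
  matNorm_smul : ∀ {n : ℕ} (c : ℂ) (x : Matrix (Fin n) (Fin n) X),
    matNorm (c • x) = ‖c‖ * matNorm x
  eq_zero_of_matNorm : ∀ {n : ℕ} (x : Matrix (Fin n) (Fin n) X), matNorm x = 0 → x = 0
  matNorm_one : ∀ x : X, matNorm (Matrix.of fun _ _ : Fin 1 => x) = ‖x‖
  matNorm_directSum : ∀ {m n : ℕ} (x : Matrix (Fin m) (Fin m) X) (y : Matrix (Fin n) (Fin n) X),
    matNorm (Matrix.reindex finSumFinEquiv finSumFinEquiv (Matrix.fromBlocks x 0 0 y)) =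
      max (matNorm x) (matNorm y)
  matNorm_twoSided_le : ∀ {m n : ℕ} (α : Matrix (Fin m) (Fin n) ℂ)
    (x : Matrix (Fin n) (Fin n) X) (β : Matrix (Fin n) (Fin m) ℂ),
    matNorm (twoSided α x β) ≤ scalarNorm α * matNorm x * scalarNorm β

/-- Norms of rectangular matrices over `X`, indexed by arbitrary finite types. This class only
carries data; its instances below are the standard matrix norms of an operator space, of `ℂ`, of
`M_{m,n}(X)`, of the dual `X*` and of the projective tensor product. -/
class MatrixNorms (X : Type*) where
  mnorm : ∀ {m n : Type} [Fintype m] [Fintype n], Matrix m n X → ℝ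

open MatrixNorms (mnorm)

/-- The rectangular matrix norms of an operator space: `x ∈ M_{m,n}(X)` is regarded as the corner
of the square matrix `[0 x; 0 0]` (by Ruan's axioms the enumeration of the index set is
irrelevant). -/
instance {X : Type*} [NormedAddCommGroup X] [NormedSpace ℂ X] [OperatorSpace X] :
    MatrixNorms X where
  mnorm {m n} _ _ x :=
    OperatorSpace.matNorm
      (Matrix.reindex (Fintype.equivFin (m ⊕ n)) (Fintype.equivFin (m ⊕ n))
        (Matrix.fromBlocks 0 x 0 0))

/-- The matrix norms of `ℂ`. -/
instance : MatrixNorms ℂ where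
  mnorm A := scalarNorm A

/-- The matrix norms of `M_{k,l}(X)`: a matrix of matrices is regarded as one large matrix. -/
instance {X : Type*} [MatrixNorms X] {k l : Type} [Fintype k] [Fintype l] :
    MatrixNorms (Matrix k l X) where
  mnorm {m n} _ _ x := mnorm (Matrix.comp m n k l X x)

/-- The column space `C_n(X) = M_{n,1}(X)`. -/
abbrev Col (n : ℕ) (X : Type*) := Matrix (Fin n) (Fin 1) X

/-- The row space `R_n(X) = M_{1,n}(X)`. -/
abbrev Row (n : ℕ) (X : Type*) := Matrix (Fin 1) (Fin n) X

/-- The dual operator space structure: `M_{m,n}(X*) = CB(X, M_{m,n})`, so that the norm of a matrix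
`f` of functionals is the completely bounded norm of `x ↦ [f_{ij}(x)]`. -/
instance {X : Type*} [NormedAddCommGroup X] [NormedSpace ℂ X] [MatrixNorms X] :
    MatrixNorms (StrongDual ℂ X) where
  mnorm {m n} _ _ f := sInf {C : ℝ | 0 ≤ C ∧ ∀ (r : ℕ) (x : Matrix (Fin r) (Fin r) X),
    scalarNorm (Matrix.of fun (a : Fin r × m) (b : Fin r × n) => f a.2 b.2 (x a.1 b.1)) ≤
      C * mnorm x}

/-- The operator space projective tensor product: the norm of a matrix `u` over `V ⊗ W` is the
infimum of `‖α‖ ‖v‖ ‖w‖ ‖β‖` over all factorizations `u = α (v ⊗ w) β` with `v ∈ M_p(V)` and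
`w ∈ M_q(W)`. -/
instance {V W : Type*} [AddCommMonoid V] [Module ℂ V] [MatrixNorms V]
    [AddCommMonoid W] [Module ℂ W] [MatrixNorms W] : MatrixNorms (V ⊗[ℂ] W) where
  mnorm {m n} _ _ u := sInf {r : ℝ | ∃ (p q : ℕ) (α : Matrix m (Fin p × Fin q) ℂ)
    (v : Matrix (Fin p) (Fin p) V) (w : Matrix (Fin q) (Fin q) W)
    (β : Matrix (Fin p × Fin q) n ℂ),
    u = twoSided α (Matrix.kroneckerMap (fun a b => a ⊗ₜ[ℂ] b) v w) β ∧
    r = scalarNorm α * mnorm v * mnorm w * scalarNorm β}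

/-- `R_n[X]`, the operator space projective tensor product of `R_n = R_n(ℂ)` with `X`. -/
abbrev RowProj (n : ℕ) (X : Type*) [AddCommMonoid X] [Module ℂ X] := Row n ℂ ⊗[ℂ] X

/-- The norm of a single element, regarded as a `1 × 1` matrix. -/
def elemNorm {X : Type*} [MatrixNorms X] (x : X) : ℝ := mnorm (Matrix.of fun _ _ : Fin 1 => x)

/-- `φ` is a complete isometry: all amplifications `φ_n : M_n(X) → M_n(Y)` preserve norms. -/
def IsCompleteIsometry {X Y : Type*} [AddCommMonoid X] [Module ℂ X] [MatrixNorms X]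
    [AddCommMonoid Y] [Module ℂ Y] [MatrixNorms Y] (φ : X →ₗ[ℂ] Y) : Prop :=
  ∀ (n : ℕ) (x : Matrix (Fin n) (Fin n) X), mnorm (φ.mapMatrix x) = mnorm x

/-- `P` is a left `M`-projection: `P² = P` and `‖x‖` is the norm of the column with entries `P x`
and `x - P x` in `C_2(X)`. -/
def IsLeftMProjection {X : Type*} [AddCommGroup X] [Module ℂ X] [MatrixNorms X]
    (P : X →ₗ[ℂ] X) : Prop :=
  P ∘ₗ P = P ∧ ∀ x : X, elemNorm x = elemNorm (!![P x; x - P x] : Col 2 X)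

/-- `P` is a complete left `M`-projection: each `P_n` is a left `M`-projection on `M_n(X)`. -/
def IsCompleteLeftMProjection {X : Type*} [AddCommGroup X] [Module ℂ X] [MatrixNorms X]
    (P : X →ₗ[ℂ] X) : Prop :=
  ∀ n : ℕ, IsLeftMProjection
    (P.mapMatrix : Matrix (Fin n) (Fin n) X →ₗ[ℂ] Matrix (Fin n) (Fin n) X)

/-- The map `X → R_2[X]`, `x ↦ [P x, x - P x]`. -/
def nuRow {X : Type*} [AddCommGroup X] [Module ℂ X] (P : X →ₗ[ℂ] X) : X →ₗ[ℂ] RowProj 2 X :=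
  TensorProduct.mk ℂ (Row 2 ℂ) X !![1, 0] ∘ₗ P +
    TensorProduct.mk ℂ (Row 2 ℂ) X !![0, 1] ∘ₗ (LinearMap.id - P)

/-- `P` is a complete right `L`-projection: `P² = P` and `x ↦ [P x, x - P x]` is a complete
isometry of `X` into `R_2[X]`. -/
def IsCompleteRightLProjection {X : Type*} [AddCommGroup X] [Module ℂ X] [MatrixNorms X]
    (P : X →ₗ[ℂ] X) : Prop :=
  P ∘ₗ P = P ∧ IsCompleteIsometry (nuRow P)

/-- The Banach space adjoint `P* : X* → X*`, `f ↦ f ∘ P`. -/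
def adjointMap {X : Type*} [NormedAddCommGroup X] [NormedSpace ℂ X] (P : X →L[ℂ] X) :
    StrongDual ℂ X →ₗ[ℂ] StrongDual ℂ X :=
  (ContinuousLinearMap.precomp ℂ P).toLinearMap

end OpSp

end

/-!
Let `T = [P, I - P]`. Then `P` is a complete left `M`-projection if and only if the column map
`x ↦ (T_s x)_s` from `X` to `C_2(X)` and the sum map `(x_s)_s ↦ ∑ T_s x_s` from `C_2(X)` to `X` are
completely contractive, and a complete right `L`-projection if and only if the column map and the
map `x ↦ [T_1 x  T_2 x]` from `X` to `R_2[X]` are. For adjoint families `T` and `T*`, the column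
conditions are equivalent, while the sum condition for either family is equivalent to the row
condition for the other, because `R_r[X]* = C_r(X*)` and `C_r(X)* = R_r[X*]`.

The second identity rests on the factorization `F x = ⟨g, a x b⟩` of a functional of norm at most
one on `M_{k,l}(X)`, with `g : X → M_{k,l}` completely contractive and `‖a‖ ‖b‖ ≤ 1 + ε` in the
Hilbert–Schmidt norm. It comes from separating the unit ball from the convex set of pairs of
Gram matrices `(α αᴴ, βᴴ β)` for which `1 ≤ Re F(α x β)` for some `x` in the unit ball.
-/

noncomputable section

namespace OpSp

open MatrixNorms (mnorm)
open Matrix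
open WithLp (toLp)

/-! ### Operator and Hilbert–Schmidt norms of scalar matrices -/

section ScalarNorm

open scoped Matrix.Norms.L2Operator

variable {m n k : Type} [Fintype m] [Fintype n] [Fintype k]

theorem scalarNorm_eq_norm [DecidableEq n] (A : Matrix m n ℂ) : scalarNorm A = ‖A‖ := by
  unfold scalarNorm
  congr!

theorem scalarNorm_nonneg (A : Matrix m n ℂ) : 0 ≤ scalarNorm A := by
  classical
  exact (scalarNorm_eq_norm A).symm ▸ norm_nonneg A

theorem scalarNorm_smul (c : ℂ) (A : Matrix m n ℂ) : scalarNorm (c • A) = ‖c‖ * scalarNorm A := by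
  classical
  simp only [scalarNorm_eq_norm, norm_smul]

theorem scalarNorm_mul_le (A : Matrix m n ℂ) (B : Matrix n k ℂ) :
    scalarNorm (A * B) ≤ scalarNorm A * scalarNorm B := by
  classical
  simpa only [scalarNorm_eq_norm] using l2_opNorm_mul A B

theorem scalarNorm_conjTranspose_mul_self (A : Matrix m n ℂ) :
    scalarNorm (Aᴴ * A) = scalarNorm A * scalarNorm A := by
  classical
  simpa only [scalarNorm_eq_norm] using l2_opNorm_conjTranspose_mul_self A

theorem scalarNorm_conjTranspose (A : Matrix m n ℂ) : scalarNorm Aᴴ = scalarNorm A := by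
  classical
  simpa only [scalarNorm_eq_norm] using l2_opNorm_conjTranspose A

theorem norm_mulVec_le (A : Matrix m n ℂ) (v : n → ℂ) :
    ‖toLp 2 (A *ᵥ v)‖ ≤ scalarNorm A * ‖toLp 2 v‖ := by
  classical
  rw [scalarNorm_eq_norm]
  exact l2_opNorm_mulVec A (toLp 2 v)

theorem scalarNorm_le_of_mulVec {A : Matrix m n ℂ} {C : ℝ} (hC : 0 ≤ C)
    (h : ∀ v, ‖toLp 2 (A *ᵥ v)‖ ≤ C * ‖toLp 2 v‖) : scalarNorm A ≤ C := by
  classical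
  rw [scalarNorm_eq_norm, l2_opNorm_def]
  exact ContinuousLinearMap.opNorm_le_bound _ hC fun v => h v.ofLp

theorem norm_dotProduct_le (u v : n → ℂ) : ‖u ⬝ᵥ v‖ ≤ ‖toLp 2 u‖ * ‖toLp 2 v‖ := by
  have h := norm_inner_le_norm (𝕜 := ℂ) (toLp 2 (star u)) (toLp 2 v)
  rw [EuclideanSpace.inner_toLp_toLp, star_star, dotProduct_comm] at h
  simpa [EuclideanSpace.norm_eq] using h

theorem scalarNorm_le_iff {A : Matrix m n ℂ} {C : ℝ} (hC : 0 ≤ C) :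
    scalarNorm A ≤ C ↔ ∀ u v, ‖u ⬝ᵥ A *ᵥ v‖ ≤ C * ‖toLp 2 u‖ * ‖toLp 2 v‖ := by
  refine ⟨fun h u v => ?_, fun h => scalarNorm_le_of_mulVec hC fun v => ?_⟩
  · calc ‖u ⬝ᵥ A *ᵥ v‖ ≤ ‖toLp 2 u‖ * (C * ‖toLp 2 v‖) := by
          grw [norm_dotProduct_le, norm_mulVec_le, h]
      _ = C * ‖toLp 2 u‖ * ‖toLp 2 v‖ := by ring
  · set w := A *ᵥ v
    have hw : ‖star w ⬝ᵥ w‖ = ‖toLp 2 w‖ * ‖toLp 2 w‖ := by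
      rw [dotProduct_comm, ← EuclideanSpace.inner_toLp_toLp, inner_self_eq_norm_sq_to_K]
      simp [sq]
    have hs : ‖toLp 2 (star w)‖ = ‖toLp 2 w‖ := by simp [EuclideanSpace.norm_eq]
    have := h (star w) v
    rw [hw, hs] at this
    rcases (norm_nonneg (toLp 2 w)).eq_or_lt with h0 | h0
    · rw [← h0]
      positivity
    · exact le_of_mul_le_mul_left (by linarith) h0

theorem scalarNorm_transpose (A : Matrix m n ℂ) : scalarNorm Aᵀ = scalarNorm A := by
  suffices h : ∀ {m n : Type} [Fintype m] [Fintype n] (A : Matrix m n ℂ),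
      scalarNorm Aᵀ ≤ scalarNorm A from (h A).antisymm (h Aᵀ)
  intro m n _ _ A
  refine (scalarNorm_le_iff (scalarNorm_nonneg A)).2 fun u v => ?_
  rw [dotProduct_mulVec, vecMul_transpose, dotProduct_comm]
  grw [(scalarNorm_le_iff (scalarNorm_nonneg A)).1 le_rfl v u]
  exact (mul_right_comm _ _ _).le

theorem scalarNorm_one_le [DecidableEq n] : scalarNorm (1 : Matrix n n ℂ) ≤ 1 :=
  scalarNorm_le_of_mulVec zero_le_one fun v => by simp

theorem scalarNorm_submatrix_one_le [DecidableEq k] {e : m → k} (he : Function.Injective e) :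
    scalarNorm ((1 : Matrix k k ℂ).submatrix e id) ≤ 1 := by
  classical
  set E := (1 : Matrix k k ℂ).submatrix e id
  have hE : Eᴴᴴ * Eᴴ = 1 := by
    rw [conjTranspose_conjTranspose, conjTranspose_submatrix, conjTranspose_one,
      ← submatrix_mul _ _ _ _ _ Function.bijective_id, one_mul, submatrix_one _ he]
  have h := scalarNorm_conjTranspose_mul_self Eᴴ
  rw [hE, scalarNorm_conjTranspose] at h
  nlinarith [scalarNorm_one_le (n := m), scalarNorm_nonneg E]

theorem scalarNorm_submatrix_one_right_le [DecidableEq k] {e : m → k}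
    (he : Function.Injective e) : scalarNorm ((1 : Matrix k k ℂ).submatrix id e) ≤ 1 := by
  rw [← scalarNorm_transpose, transpose_submatrix, transpose_one]
  exact scalarNorm_submatrix_one_le he

theorem scalarNorm_fromRows_sq_le (A : Matrix m n ℂ) (B : Matrix k n ℂ) :
    scalarNorm (fromRows A B) ^ 2 ≤ scalarNorm A ^ 2 + scalarNorm B ^ 2 := by
  classical
  rw [sq, sq, sq, ← scalarNorm_conjTranspose_mul_self, ← scalarNorm_conjTranspose_mul_self A,
    ← scalarNorm_conjTranspose_mul_self B, conjTranspose_fromRows_eq_fromCols_conjTranspose,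
    fromCols_mul_fromRows]
  simpa only [scalarNorm_eq_norm] using norm_add_le _ _

theorem scalarNorm_fromCols_sq_le (A : Matrix m n ℂ) (B : Matrix m k ℂ) :
    scalarNorm (fromCols A B) ^ 2 ≤ scalarNorm A ^ 2 + scalarNorm B ^ 2 := by
  simpa only [← transpose_fromCols, scalarNorm_transpose] using scalarNorm_fromRows_sq_le Aᵀ Bᵀ

theorem norm_toLp_sumElim_sq (u : m ⊕ n → ℂ) :
    ‖toLp 2 u‖ ^ 2 = ‖toLp 2 (u ∘ Sum.inl)‖ ^ 2 + ‖toLp 2 (u ∘ Sum.inr)‖ ^ 2 := by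
  simp [EuclideanSpace.norm_sq_eq]

theorem scalarNorm_fromBlocks_le {l : Type} [Fintype l] (A : Matrix m n ℂ) (B : Matrix k l ℂ) :
    scalarNorm (fromBlocks A 0 0 B) ≤ max (scalarNorm A) (scalarNorm B) := by
  set C := max (scalarNorm A) (scalarNorm B)
  have hC : 0 ≤ C := (scalarNorm_nonneg A).trans (le_max_left _ _)
  refine scalarNorm_le_of_mulVec hC fun v => le_of_sq_le_sq ?_ (by positivity)
  rw [fromBlocks_mulVec, norm_toLp_sumElim_sq, mul_pow, norm_toLp_sumElim_sq v, mul_add,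
    ← mul_pow, ← mul_pow]
  simp only [zero_mulVec, add_zero, zero_add, Sum.elim_comp_inl, Sum.elim_comp_inr]
  gcongr
  · grw [norm_mulVec_le, show scalarNorm A ≤ C from le_max_left _ _]
  · grw [norm_mulVec_le, show scalarNorm B ≤ C from le_max_right _ _]

end ScalarNorm

section Frobenius

open scoped Matrix.Norms.Frobenius Kronecker

variable {m n k l : Type} [Fintype m] [Fintype n] [Fintype k] [Fintype l]

theorem frobenius_norm_sq (A : Matrix m n ℂ) : ‖A‖ ^ 2 = ∑ i, ∑ j, ‖A i j‖ ^ 2 := by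
  rw [frobenius_norm_def, ← Real.sqrt_eq_rpow, Real.sq_sqrt (by positivity)]
  simp only [Real.rpow_ofNat]

theorem norm_toLp_vec (A : Matrix m n ℂ) : ‖toLp 2 (vec A)‖ = ‖A‖ := by
  rw [← sq_eq_sq₀ (norm_nonneg _) (norm_nonneg _), EuclideanSpace.norm_sq_eq, frobenius_norm_sq,
    Finset.sum_comm, Fintype.sum_prod_type]
  rfl

theorem norm_mul_le_scalarNorm_mul (A : Matrix m n ℂ) (B : Matrix n k ℂ) :
    ‖A * B‖ ≤ scalarNorm A * ‖B‖ := by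
  have hsum {p : Type} [Fintype p] (M : Matrix p k ℂ) :
      ‖M‖ ^ 2 = ∑ j, ‖toLp 2 (Mᵀ j)‖ ^ 2 := by
    simp only [EuclideanSpace.norm_sq_eq, ← frobenius_norm_transpose M, frobenius_norm_sq]
  refine le_of_sq_le_sq ?_ (mul_nonneg (scalarNorm_nonneg A) (norm_nonneg B))
  rw [mul_pow, hsum, hsum, Finset.mul_sum]
  gcongr with j
  rw [← mul_pow]
  gcongr
  exact norm_mulVec_le A (Bᵀ j)

theorem norm_mul_le_mul_scalarNorm (A : Matrix m n ℂ) (B : Matrix n k ℂ) :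
    ‖A * B‖ ≤ ‖A‖ * scalarNorm B := by
  rw [← frobenius_norm_transpose, transpose_mul, mul_comm, ← frobenius_norm_transpose A,
    ← scalarNorm_transpose]
  exact norm_mul_le_scalarNorm_mul Bᵀ Aᵀ

theorem scalarNorm_le_norm (A : Matrix m n ℂ) : scalarNorm A ≤ ‖A‖ := by
  refine scalarNorm_le_of_mulVec (norm_nonneg A) fun v => ?_
  have h := frobenius_norm_mul A (replicateCol Unit v)
  rwa [← replicateCol_mulVec, frobenius_norm_replicateCol, frobenius_norm_replicateCol] at h

theorem scalarNorm_kronecker_le (A : Matrix m n ℂ) (B : Matrix k l ℂ) :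
    scalarNorm (A ⊗ₖ B) ≤ scalarNorm A * scalarNorm B := by
  have hAB := mul_nonneg (scalarNorm_nonneg A) (scalarNorm_nonneg B)
  refine scalarNorm_le_of_mulVec hAB fun v => ?_
  obtain ⟨X, rfl⟩ : ∃ X : Matrix l n ℂ, vec X = v := ⟨of fun j i => v (i, j), rfl⟩
  rw [kronecker_mulVec_vec, norm_toLp_vec, norm_toLp_vec]
  calc ‖B * X * Aᵀ‖ ≤ scalarNorm B * ‖X‖ * scalarNorm A := by
        grw [norm_mul_le_mul_scalarNorm, norm_mul_le_scalarNorm_mul, scalarNorm_transpose]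
        exact scalarNorm_nonneg _
    _ = scalarNorm A * scalarNorm B * ‖X‖ := by ring

end Frobenius

/-! ### Ruan's axioms -/

section TwoSided

variable {V W : Type*} [AddCommGroup V] [Module ℂ V] [AddCommGroup W] [Module ℂ W]
variable {m n k l k' l' : Type} [Fintype k] [Fintype l] [Fintype k'] [Fintype l']

theorem twoSided_apply (α : Matrix m k ℂ) (x : Matrix k l V) (β : Matrix l n ℂ) (i : m) (j : n) :
    twoSided α x β i j = ∑ p : k × l, (α i p.1 * β p.2 j) • x p.1 p.2 :=
  (Fintype.sum_prod_type' fun p q => (α i p * β q j) • x p q).symm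

theorem twoSided_twoSided (α : Matrix m k ℂ) (α' : Matrix k k' ℂ) (x : Matrix k' l' V)
    (β' : Matrix l' l ℂ) (β : Matrix l n ℂ) :
    twoSided α (twoSided α' x β') β = twoSided (α * α') x (β' * β) := by
  ext i j
  simp only [twoSided_apply, Finset.smul_sum, smul_smul, mul_apply]
  rw [Finset.sum_comm]
  refine Finset.sum_congr rfl fun p _ => ?_
  rw [Finset.sum_mul_sum, ← Fintype.sum_prod_type', Finset.sum_smul]
  exact Finset.sum_congr rfl fun q _ => by ring_nf

theorem twoSided_smul_smul_smul (a c b : ℂ) (α : Matrix m k ℂ) (x : Matrix k l V)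
    (β : Matrix l n ℂ) : twoSided (a • α) (c • x) (b • β) = (a * c * b) • twoSided α x β := by
  ext i j
  simp only [twoSided_apply, Matrix.smul_apply, Finset.smul_sum, smul_smul, smul_eq_mul]
  exact Finset.sum_congr rfl fun p _ => by ring_nf

theorem twoSided_submatrix_one [DecidableEq k] [DecidableEq l] (e : m → k) (f : n → l)
    (x : Matrix k l V) :
    twoSided ((1 : Matrix k k ℂ).submatrix e id) x ((1 : Matrix l l ℂ).submatrix id f) =
      x.submatrix e f := by
  ext i j
  rw [twoSided_apply, Finset.sum_eq_single (e i, f j) (fun p _ hp => ?_) (by simp)]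
  · simp [one_apply]
  · obtain h | h : e i ≠ p.1 ∨ p.2 ≠ f j := by
      by_contra! h
      exact hp (Prod.ext h.1.symm h.2)
    all_goals simp [one_apply, h]

@[simp]
theorem twoSided_one [DecidableEq k] [DecidableEq l] (x : Matrix k l V) : twoSided 1 x 1 = x := by
  simpa using twoSided_submatrix_one id id x

theorem map_twoSided (T : V →ₗ[ℂ] W) (α : Matrix m k ℂ) (x : Matrix k l V) (β : Matrix l n ℂ) :
    (twoSided α x β).map T = twoSided α (x.map T) β := by
  ext i j
  simp [twoSided_apply]

theorem twoSided_fromCols_fromBlocks_fromRows (α : Matrix m k ℂ) (α' : Matrix m k' ℂ)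
    (x : Matrix k l V) (x' : Matrix k' l' V) (β : Matrix l n ℂ) (β' : Matrix l' n ℂ) :
    twoSided (fromCols α α') (fromBlocks x 0 0 x') (fromRows β β') =
      twoSided α x β + twoSided α' x' β' := by
  ext i j
  simp [twoSided, Fintype.sum_sum_type]

theorem twoSided_fromBlocks {m' n' : Type} (α : Matrix m k ℂ) (α' : Matrix m' k' ℂ)
    (x : Matrix k l V) (x' : Matrix k' l' V) (β : Matrix l n ℂ) (β' : Matrix l' n' ℂ) :
    twoSided (fromBlocks α 0 0 α') (fromBlocks x 0 0 x') (fromBlocks β 0 0 β') =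
      fromBlocks (twoSided α x β) 0 0 (twoSided α' x' β') := by
  ext (i | i) (j | j) <;> simp [twoSided, Fintype.sum_sum_type]

variable [Fintype m] [Fintype n]

/-- The pairing `x ↦ ∑ fᵢⱼ(xᵢⱼ)` of a matrix of functionals with a matrix of vectors. -/
def pair (f : Matrix m n (Module.Dual ℂ V)) : Matrix m n V →ₗ[ℂ] ℂ :=
  ∑ p : m × n, f p.1 p.2 ∘ₗ entryLinearMap ℂ V p.1 p.2

theorem pair_apply (f : Matrix m n (Module.Dual ℂ V)) (x : Matrix m n V) :
    pair f x = ∑ p : m × n, f p.1 p.2 (x p.1 p.2) := by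
  simp [pair]

theorem pair_twoSided (f : Matrix m n (Module.Dual ℂ V)) (α : Matrix m k ℂ) (x : Matrix k l V)
    (β : Matrix l n ℂ) : pair f (twoSided α x β) = pair (twoSided αᵀ f βᵀ) x := by
  simp only [pair_apply, twoSided_apply, map_sum, map_smul, LinearMap.sum_apply,
    LinearMap.smul_apply, transpose_apply]
  exact Finset.sum_comm

theorem pair_fromBlocks (f : Matrix m n (Module.Dual ℂ V)) (f' : Matrix k l (Module.Dual ℂ V))
    (x : Matrix (m ⊕ k) (n ⊕ l) V) :
    pair (fromBlocks f 0 0 f') x = pair f x.toBlocks₁₁ + pair f' x.toBlocks₂₂ := by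
  simp [pair_apply, Fintype.sum_prod_type, Fintype.sum_sum_type, toBlocks₁₁, toBlocks₂₂]

theorem pair_single [DecidableEq m] [DecidableEq n] (f : Matrix m n (Module.Dual ℂ V)) (i : m)
    (j : n) (x : V) : pair f (single i j x) = f i j x := by
  rw [pair_apply, Fintype.sum_eq_single (i, j) fun p hp => ?_, single_apply_same]
  rw [single_apply_of_ne, map_zero]
  exact fun h => hp (Prod.ext h.1.symm h.2.symm)

theorem pair_injective :
    Function.Injective (pair : Matrix m n (Module.Dual ℂ V) → Matrix m n V →ₗ[ℂ] ℂ) := by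
  classical
  intro f g h
  ext i j x
  rw [← pair_single f, h, pair_single]

theorem exists_pair_eq (F : Matrix m n V →ₗ[ℂ] ℂ) : ∃ f, pair f = F := by
  classical
  refine ⟨of fun i j => F ∘ₗ singleLinearMap ℂ i j, LinearMap.ext fun x => ?_⟩
  conv_rhs => rw [matrix_eq_sum_single x]
  simp [pair_apply, Fintype.sum_prod_type]

end TwoSided

/-- Ruan's axioms for the rectangular matrix norms of a complex vector space. Together they imply
that each `mnorm` is a seminorm (`mnorm_add_le`, `mnorm_smul`). -/
class RuanNorms (V : Type*) [AddCommGroup V] [Module ℂ V] [MatrixNorms V] : Prop where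
  mnorm_nonneg : ∀ {m n : Type} [Fintype m] [Fintype n] (x : Matrix m n V), 0 ≤ mnorm x
  mnorm_twoSided_le : ∀ {m n k l : Type} [Fintype m] [Fintype n] [Fintype k] [Fintype l]
    (α : Matrix m k ℂ) (x : Matrix k l V) (β : Matrix l n ℂ),
    mnorm (twoSided α x β) ≤ scalarNorm α * mnorm x * scalarNorm β
  mnorm_fromBlocks_le : ∀ {m n k l : Type} [Fintype m] [Fintype n] [Fintype k] [Fintype l]
    (x : Matrix m n V) (y : Matrix k l V), mnorm (fromBlocks x 0 0 y) ≤ max (mnorm x) (mnorm y)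

open RuanNorms (mnorm_nonneg mnorm_twoSided_le mnorm_fromBlocks_le)

section RuanNorms

variable {V : Type*} [AddCommGroup V] [Module ℂ V] [MatrixNorms V] [RuanNorms V]
variable {m n k l : Type} [Fintype m] [Fintype n] [Fintype k] [Fintype l]

theorem mnorm_twoSided_le_of_le {α : Matrix m k ℂ} {x : Matrix k l V} {β : Matrix l n ℂ}
    {a c b : ℝ} (hα : scalarNorm α ≤ a) (hx : mnorm x ≤ c) (hβ : scalarNorm β ≤ b) :
    mnorm (twoSided α x β) ≤ a * c * b := by
  have ha := (scalarNorm_nonneg α).trans hα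
  have hc := (mnorm_nonneg x).trans hx
  exact (mnorm_twoSided_le α x β).trans (mul_le_mul (mul_le_mul hα hx (mnorm_nonneg x) ha) hβ
    (scalarNorm_nonneg β) (mul_nonneg ha hc))

theorem mnorm_twoSided_le_of_le_one {α : Matrix m k ℂ} (x : Matrix k l V) {β : Matrix l n ℂ}
    (hα : scalarNorm α ≤ 1) (hβ : scalarNorm β ≤ 1) : mnorm (twoSided α x β) ≤ mnorm x := by
  simpa using mnorm_twoSided_le_of_le hα le_rfl hβ

theorem mnorm_smul_le (c : ℂ) (x : Matrix m n V) : mnorm (c • x) ≤ ‖c‖ * mnorm x := by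
  classical
  have h : mnorm (twoSided (c • (1 : Matrix m m ℂ)) ((1 : ℂ) • x) ((1 : ℂ) • (1 : Matrix n n ℂ))) ≤
      ‖c‖ * mnorm x * 1 := by
    refine mnorm_twoSided_le_of_le ?_ (by simp) (by simpa using scalarNorm_one_le)
    rw [scalarNorm_smul]
    exact mul_le_of_le_one_right (norm_nonneg c) scalarNorm_one_le
  rwa [twoSided_smul_smul_smul, twoSided_one, mul_one, mul_one, mul_one] at h

theorem mnorm_smul (c : ℂ) (x : Matrix m n V) : mnorm (c • x) = ‖c‖ * mnorm x := by
  refine (mnorm_smul_le c x).antisymm ?_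
  rcases eq_or_ne c 0 with rfl | hc
  · simpa using mnorm_nonneg _
  · have h := mnorm_smul_le c⁻¹ (c • x)
    rwa [inv_smul_smul₀ hc, norm_inv, inv_mul_eq_div, le_div_iff₀' (norm_pos_iff.2 hc)] at h

@[simp]
theorem mnorm_zero : mnorm (0 : Matrix m n V) = 0 := by
  simpa using mnorm_smul 0 (0 : Matrix m n V)

theorem mnorm_submatrix_le (x : Matrix k l V) {e : m → k} {f : n → l}
    (he : Function.Injective e) (hf : Function.Injective f) :
    mnorm (x.submatrix e f) ≤ mnorm x := by
  classical
  rw [← twoSided_submatrix_one]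
  exact mnorm_twoSided_le_of_le_one x (scalarNorm_submatrix_one_le he)
    (scalarNorm_submatrix_one_right_le hf)

theorem mnorm_submatrix_equiv (x : Matrix k l V) (e : m ≃ k) (f : n ≃ l) :
    mnorm (x.submatrix e f) = mnorm x :=
  (mnorm_submatrix_le x e.injective f.injective).antisymm <| by
    simpa using mnorm_submatrix_le (x.submatrix e f) e.symm.injective f.symm.injective

theorem mnorm_add_le (x y : Matrix m n V) : mnorm (x + y) ≤ mnorm x + mnorm y := by
  classical
  -- For `a > ‖x‖` and `b > ‖y‖`, `x + y` is the compression of the contraction `a⁻¹x ⊕ b⁻¹y` by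
  -- the row and the column with entries `√a`, `√b`, whose norms are at most `√(a + b)`.
  suffices h : ∀ a b, mnorm x < a → mnorm y < b → mnorm (x + y) ≤ a + b from
    le_of_forall_pos_le_add fun ε hε =>
      (h _ _ (lt_add_of_pos_right _ (half_pos hε)) (lt_add_of_pos_right _ (half_pos hε))).trans
        (by linarith)
  intro a b hxa hyb
  have ha := (mnorm_nonneg x).trans_lt hxa
  have hb := (mnorm_nonneg y).trans_lt hyb
  let R (p : Type) [DecidableEq p] : Matrix p (p ⊕ p) ℂ := fromCols ((√a : ℂ) • 1) ((√b : ℂ) • 1)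
  have hR (p : Type) [Fintype p] [DecidableEq p] : scalarNorm (R p) ≤ √(a + b) := by
    have hs {c : ℝ} (hc : 0 ≤ c) : scalarNorm ((√c : ℂ) • (1 : Matrix p p ℂ)) ^ 2 ≤ c := by
      have h1 := scalarNorm_nonneg (1 : Matrix p p ℂ)
      grw [scalarNorm_smul, scalarNorm_one_le]
      simp [Real.sq_sqrt hc]
    exact Real.le_sqrt_of_sq_le
      ((scalarNorm_fromCols_sq_le _ _).trans (add_le_add (hs ha.le) (hs hb.le)))
  let z := fromBlocks ((a⁻¹ : ℂ) • x) 0 0 ((b⁻¹ : ℂ) • y)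
  have hz : mnorm z ≤ 1 := by
    refine (mnorm_fromBlocks_le _ _).trans (max_le ?_ ?_) <;>
      rw [mnorm_smul, norm_inv, Complex.norm_of_nonneg (by positivity),
        inv_mul_le_iff₀ (by positivity)] <;> linarith
  have hxy : x + y = twoSided (R m) z (R n)ᵀ := by
    have hs {c : ℝ} (hc : 0 < c) : (√c * (c : ℂ)⁻¹ * √c : ℂ) = 1 := by
      rw [mul_right_comm, ← Complex.ofReal_mul, Real.mul_self_sqrt hc.le]
      exact mul_inv_cancel₀ (by exact_mod_cast hc.ne')
    simp only [R, z, transpose_fromCols, twoSided_fromCols_fromBlocks_fromRows, transpose_smul,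
      transpose_one, twoSided_smul_smul_smul, twoSided_one, hs ha, hs hb, one_smul]
  calc mnorm (x + y) ≤ √(a + b) * 1 * √(a + b) := hxy ▸
        mnorm_twoSided_le_of_le (hR m) hz ((scalarNorm_transpose _).trans_le (hR n))
    _ = a + b := by rw [mul_one, Real.mul_self_sqrt (by positivity)]

end RuanNorms

/-! ### Factorization of contractive functionals -/

section Separation

theorem exists_functional_of_disjoint_ball {E : Type*} [NormedAddCommGroup E] [NormedSpace ℂ E]
    {s : Set E} (hs : Convex ℝ s) (h : Disjoint (Metric.ball 0 1) s) :
    ∃ f : E →ₗ[ℂ] ℂ, (∀ a, ‖a‖ ≤ 1 → (f a).re ≤ 1) ∧ ∀ a ∈ s, 1 ≤ (f a).re := by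
  obtain ⟨f, u, hf, hfs⟩ :=
    RCLike.geometric_hahn_banach_open (𝕜 := ℂ) (convex_ball 0 1) Metric.isOpen_ball hs h
  have hu : 0 < u := by simpa using hf 0 (Metric.mem_ball_self one_pos)
  have hball : Metric.closedBall (0 : E) 1 ⊆ {a | (f a).re ≤ u} := by
    rw [← closure_ball _ one_ne_zero]
    exact closure_minimal (fun a ha => (hf a ha).le) (isClosed_le (by fun_prop) continuous_const)
  have hre (a : E) : (((u⁻¹ : ℝ) : ℂ) * f a).re = u⁻¹ * (f a).re := Complex.re_ofReal_mul _ _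
  refine ⟨((u⁻¹ : ℝ) : ℂ) • f.toLinearMap, fun a ha => ?_, fun a ha => ?_⟩
  · exact (hre a).trans_le ((inv_mul_le_one₀ hu).2 (hball (mem_closedBall_zero_iff.2 ha)))
  · exact ((one_le_inv_mul₀ hu).2 (hfs a ha)).trans_eq (hre a).symm

variable {V : Type*} [AddCommGroup V] [Module ℂ V] [MatrixNorms V]
variable {m n k l : Type} [Fintype m] [Fintype n]

theorem sqrt_smul_mul_conjTranspose {t : ℝ} (ht : 0 ≤ t) (α : Matrix k m ℂ) :
    ((√t : ℂ) • α) * ((√t : ℂ) • α)ᴴ = t • (α * αᴴ) := by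
  rw [conjTranspose_smul, smul_mul, Matrix.mul_smul, smul_smul, RCLike.star_def,
    Complex.conj_ofReal, ← Complex.ofReal_mul, Real.mul_self_sqrt ht, Complex.coe_smul]

theorem sqrt_smul_conjTranspose_mul {t : ℝ} (ht : 0 ≤ t) (β : Matrix n l ℂ) :
    ((√t : ℂ) • β)ᴴ * ((√t : ℂ) • β) = t • (βᴴ * β) := by
  simpa using sqrt_smul_mul_conjTranspose ht βᴴ

theorem fromCols_mul_conjTranspose {m' : Type} [Fintype m'] (α : Matrix k m ℂ)
    (α' : Matrix k m' ℂ) : fromCols α α' * (fromCols α α')ᴴ = α * αᴴ + α' * α'ᴴ := by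
  rw [conjTranspose_fromCols_eq_fromRows_conjTranspose, fromCols_mul_fromRows]

theorem fromRows_conjTranspose_mul {n' : Type} [Fintype n'] (β : Matrix n l ℂ)
    (β' : Matrix n' l ℂ) : (fromRows β β')ᴴ * fromRows β β' = βᴴ * β + β'ᴴ * β' := by
  rw [conjTranspose_fromRows_eq_fromCols_conjTranspose, fromCols_mul_fromRows]

/-- The pairs of Gram matrices `(α αᴴ, βᴴ β)` such that `1 ≤ Re F(α x β)` for some `x` in the unit
ball. Separating this convex set from the unit ball factorizes a contractive functional `F`. -/
def gramSet (F : Matrix k l V →ₗ[ℂ] ℂ) : Set (Matrix k k ℂ × Matrix l l ℂ) :=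
  {A | ∃ (m n : Type) (_ : Fintype m) (_ : Fintype n) (α : Matrix k m ℂ) (x : Matrix m n V)
    (β : Matrix n l ℂ), mnorm x ≤ 1 ∧ 1 ≤ (F (twoSided α x β)).re ∧ (α * αᴴ, βᴴ * β) = A}

variable [RuanNorms V] {F : Matrix k l V →ₗ[ℂ] ℂ}

theorem convex_gramSet (F : Matrix k l V →ₗ[ℂ] ℂ) : Convex ℝ (gramSet F) := by
  rintro _ ⟨m, n, _, _, α, x, β, hx, hF, rfl⟩ _ ⟨m', n', _, _, α', x', β', hx', hF', rfl⟩
    s t hs ht hst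
  refine ⟨m ⊕ m', n ⊕ n', inferInstance, inferInstance, fromCols ((√s : ℂ) • α) ((√t : ℂ) • α'),
    fromBlocks x 0 0 x', fromRows ((√s : ℂ) • β) ((√t : ℂ) • β'),
    (mnorm_fromBlocks_le x x').trans (max_le hx hx'), ?_, ?_⟩
  · have hsqrt {c : ℝ} (hc : 0 ≤ c) (y : Matrix k l V) :
        (F ((√c * 1 * √c : ℂ) • y)).re = c * (F y).re := by
      rw [mul_one, ← Complex.ofReal_mul, Real.mul_self_sqrt hc, map_smul, smul_eq_mul,
        Complex.re_ofReal_mul]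
    rw [← one_smul ℂ x, ← one_smul ℂ x', twoSided_fromCols_fromBlocks_fromRows,
      twoSided_smul_smul_smul, twoSided_smul_smul_smul, map_add, Complex.add_re, hsqrt hs, hsqrt ht]
    nlinarith
  · rw [fromCols_mul_conjTranspose, fromRows_conjTranspose_mul, sqrt_smul_mul_conjTranspose hs,
      sqrt_smul_mul_conjTranspose ht, sqrt_smul_conjTranspose_mul hs,
      sqrt_smul_conjTranspose_mul ht]
    rfl

theorem add_mem_gramSet {A : Matrix k k ℂ × Matrix l l ℂ} (hA : A ∈ gramSet F)
    (γ : Matrix k m ℂ) (δ : Matrix n l ℂ) : A + (γ * γᴴ, δᴴ * δ) ∈ gramSet F := by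
  obtain ⟨p, q, _, _, α, x, β, hx, hF, rfl⟩ := hA
  refine ⟨p ⊕ m, q ⊕ n, inferInstance, inferInstance, fromCols α γ, fromBlocks x 0 0 0,
    fromRows β δ, (mnorm_fromBlocks_le x 0).trans (max_le hx (by simp)), ?_, ?_⟩
  · have h0 : twoSided γ (0 : Matrix m n V) δ = 0 := by
      ext
      simp [twoSided_apply]
    rwa [twoSided_fromCols_fromBlocks_fromRows, h0, add_zero]
  · rw [fromCols_mul_conjTranspose, fromRows_conjTranspose_mul]
    rfl

theorem re_nonneg_of_gramSet {f : Matrix k k ℂ × Matrix l l ℂ →ₗ[ℂ] ℂ} (hne : (gramSet F).Nonempty)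
    (hf : ∀ A ∈ gramSet F, 1 ≤ (f A).re) (γ : Matrix k m ℂ) (δ : Matrix n l ℂ) :
    0 ≤ (f (γ * γᴴ, δᴴ * δ)).re := by
  obtain ⟨A, hA⟩ := hne
  set s := (f (γ * γᴴ, δᴴ * δ)).re
  have hray (t : ℝ) (ht : 0 ≤ t) : 1 ≤ (f A).re + t * s := by
    have h := hf _ (add_mem_gramSet hA ((√t : ℂ) • γ) ((√t : ℂ) • δ))
    rwa [sqrt_smul_mul_conjTranspose ht, sqrt_smul_conjTranspose_mul ht, ← Prod.smul_mk,
      ← Complex.coe_smul, map_add, map_smul, smul_eq_mul, Complex.add_re,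
      Complex.re_ofReal_mul] at h
  by_contra! hneg
  have hA1 := hf A hA
  have h := hray ((f A).re / -s) (div_nonneg (by linarith) (by linarith))
  rw [div_neg, neg_mul, div_mul_cancel₀ _ hneg.ne] at h
  linarith

theorem inv_smul_mem_gramSet {α : Matrix k m ℂ} {x : Matrix m n V} {β : Matrix n l ℂ} {a c b : ℝ}
    (ha : 0 < a) (hx : mnorm x < c) (hb : 0 < b) (h : a * b ≤ ‖F (twoSided α x β)‖ / c) :
    (((a : ℂ)⁻¹ • α) * ((a : ℂ)⁻¹ • α)ᴴ, ((b : ℂ)⁻¹ • β)ᴴ * ((b : ℂ)⁻¹ • β)) ∈ gramSet F := by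
  have hc := (mnorm_nonneg x).trans_lt hx
  obtain ⟨ω, hω, hωF⟩ := RCLike.exists_norm_eq_mul_self (F (twoSided α x β))
  refine ⟨m, n, inferInstance, inferInstance, _, (ω * (c : ℂ)⁻¹) • x, _, ?_, ?_, rfl⟩
  · rw [mnorm_smul, norm_mul, hω, one_mul, norm_inv, Complex.norm_of_nonneg hc.le,
      inv_mul_le_one₀ hc]
    exact hx.le
  · have hωF' : (a : ℂ)⁻¹ * (ω * (c : ℂ)⁻¹) * (b : ℂ)⁻¹ * F (twoSided α x β) =
        ((a * b)⁻¹ * (‖F (twoSided α x β)‖ / c) : ℝ) := by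
      push_cast
      rw [show (‖F (twoSided α x β)‖ : ℂ) = _ from hωF]
      ring
    rw [twoSided_smul_smul_smul, map_smul, smul_eq_mul, hωF', Complex.ofReal_re,
      one_le_inv_mul₀ (by positivity)]
    exact h

variable [Fintype k] [Fintype l]

open scoped Matrix.Norms.L2Operator in
theorem disjoint_ball_gramSet [DecidableEq k] [DecidableEq l] (hF : ∀ x, ‖F x‖ ≤ mnorm x) :
    Disjoint (Metric.ball 0 1) (gramSet F) := by
  rw [Set.disjoint_left]
  rintro _ hA ⟨m, n, _, _, α, x, β, hx, hFx, rfl⟩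
  rw [mem_ball_zero_iff, Prod.norm_mk, max_lt_iff, ← scalarNorm_eq_norm, ← scalarNorm_eq_norm,
    scalarNorm_conjTranspose_mul_self] at hA
  obtain ⟨hα, hβ⟩ := hA
  nth_rw 1 [← conjTranspose_conjTranspose α] at hα
  rw [scalarNorm_conjTranspose_mul_self, scalarNorm_conjTranspose] at hα
  have hle : (1 : ℝ) ≤ scalarNorm α * 1 * scalarNorm β :=
    calc (1 : ℝ) ≤ ‖F (twoSided α x β)‖ := hFx.trans (Complex.re_le_norm _)
      _ ≤ mnorm (twoSided α x β) := hF _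
      _ ≤ scalarNorm α * 1 * scalarNorm β := mnorm_twoSided_le_of_le le_rfl hx le_rfl
  nlinarith [sq_nonneg (scalarNorm α - scalarNorm β)]

theorem exists_positive_functionals [DecidableEq k] [DecidableEq l]
    (hF : ∀ x, ‖F x‖ ≤ mnorm x) :
    ∃ (f : Matrix k k ℂ →ₗ[ℂ] ℂ) (g : Matrix l l ℂ →ₗ[ℂ] ℂ),
      (∀ γ : Matrix k Unit ℂ, 0 ≤ (f (γ * γᴴ)).re) ∧
      (∀ γ : Matrix l Unit ℂ, 0 ≤ (g (γ * γᴴ)).re) ∧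
      (f 1).re + (g 1).re ≤ 1 ∧ ∀ A ∈ gramSet F, 1 ≤ (f A.1).re + (g A.2).re := by
  open scoped Matrix.Norms.L2Operator in
  rcases (gramSet F).eq_empty_or_nonempty with hemp | hne
  · exact ⟨0, 0, by simp, by simp, by simp, by simp [hemp]⟩
  obtain ⟨f, hf1, hf⟩ :=
    exists_functional_of_disjoint_ball (convex_gramSet F) (disjoint_ball_gramSet hF)
  have hsum (A) : ((f ∘ₗ LinearMap.inl ℂ _ _) A.1).re + ((f ∘ₗ LinearMap.inr ℂ _ _) A.2).re =
      (f A).re := by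
    simp [← Complex.add_re, ← map_add]
  refine ⟨f ∘ₗ LinearMap.inl ℂ _ _, f ∘ₗ LinearMap.inr ℂ _ _, fun γ => ?_, fun γ => ?_, ?_,
    fun A hA => (hf A hA).trans_eq (hsum A).symm⟩
  · simpa using re_nonneg_of_gramSet hne hf γ (0 : Matrix Unit l ℂ)
  · simpa using re_nonneg_of_gramSet hne hf (0 : Matrix k Unit ℂ) γᴴ
  · refine (hsum (1, 1)).trans_le (hf1 _ ?_)
    simp only [Prod.norm_mk, ← scalarNorm_eq_norm, max_le_iff]
    exact ⟨scalarNorm_one_le, scalarNorm_one_le⟩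

end Separation

section Factorization

open scoped ComplexOrder Matrix.Norms.Frobenius

variable {m n k l : Type} [Fintype m] [Fintype n] [Fintype k] [Fintype l]

theorem exists_trace_mul_eq (f : Matrix k k ℂ →ₗ[ℂ] ℂ) :
    ∃ ρ : Matrix k k ℂ, ∀ A, (ρ * A).trace = f A := by
  classical
  refine ⟨of fun i j => f (single j i 1), LinearMap.congr_fun (f := traceLinearMap k ℂ ℂ ∘ₗ
    LinearMap.mulLeft ℂ _) (Matrix.ext_linearMap ℂ fun i j => LinearMap.ext_ring ?_)⟩
  simp [trace_mul_single]

theorem trace_mul_conjTranspose_self (A : Matrix m n ℂ) : (A * Aᴴ).trace = (‖A‖ ^ 2 : ℝ) := by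
  simp [frobenius_norm_sq, trace, mul_apply, Complex.mul_conj, Complex.normSq_eq_norm_sq]

theorem trace_add_conjTranspose_mul (ρ : Matrix k k ℂ) (α : Matrix k m ℂ) :
    ((ρ + ρᴴ) * (α * αᴴ)).trace = (2 * (ρ * (α * αᴴ)).trace.re : ℝ) := by
  have h : (ρᴴ * (α * αᴴ)).trace = star (ρ * (α * αᴴ)).trace := by
    rw [← trace_conjTranspose, conjTranspose_mul, trace_mul_comm ρᴴ, conjTranspose_mul,
      conjTranspose_conjTranspose]
  rw [Matrix.add_mul, trace_add, h, RCLike.star_def, Complex.add_conj]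

theorem exists_density [DecidableEq k] {f : Matrix k k ℂ →ₗ[ℂ] ℂ}
    (hf : ∀ γ : Matrix k Unit ℂ, 0 ≤ (f (γ * γᴴ)).re) {δ : ℝ} (hδ : 0 < δ) :
    ∃ a : Matrix k k ℂ, IsUnit a ∧ ∀ {m : Type} [Fintype m] (α : Matrix k m ℂ),
      ‖a * α‖ ^ 2 = 2 * (f (α * αᴴ)).re + δ * ‖α‖ ^ 2 := by
  obtain ⟨ρ, hρ⟩ := exists_trace_mul_eq f
  have hpsd : (ρ + ρᴴ).PosSemidef := by
    refine .of_dotProduct_mulVec_nonneg (by simp [IsHermitian, add_comm]) fun v => ?_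
    have h : star v ⬝ᵥ (ρ + ρᴴ) *ᵥ v =
        ((ρ + ρᴴ) * (replicateCol Unit v * (replicateCol Unit v)ᴴ)).trace := by
      rw [conjTranspose_replicateCol, ← vecMulVec_eq, mul_vecMulVec, trace_vecMulVec,
        dotProduct_comm]
    rw [h, trace_add_conjTranspose_mul, hρ]
    exact_mod_cast mul_nonneg zero_le_two (hf _)
  have hpd : (ρ + ρᴴ + (δ : ℂ) • (1 : Matrix k k ℂ)).PosDef :=
    .posSemidef_add hpsd (PosDef.one.smul (by exact_mod_cast hδ))
  obtain ⟨a, ha⟩ : ∃ a : Matrix k k ℂ, ρ + ρᴴ + (δ : ℂ) • (1 : Matrix k k ℂ) = aᴴ * a := by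
    open scoped MatrixOrder in
    exact CStarAlgebra.nonneg_iff_eq_star_mul_self.1 (nonneg_iff_posSemidef.2 hpd.posSemidef)
  have haU : IsUnit a := isUnit_of_mul_isUnit_right (ha ▸ hpd.isUnit : IsUnit (aᴴ * a))
  refine ⟨a, haU, fun α => Complex.ofReal_injective ?_⟩
  calc ((‖a * α‖ ^ 2 : ℝ) : ℂ) = (a * α * (a * α)ᴴ).trace := (trace_mul_conjTranspose_self _).symm
    _ = (aᴴ * a * (α * αᴴ)).trace := by
      rw [conjTranspose_mul, ← Matrix.mul_assoc, trace_mul_comm]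
      simp only [Matrix.mul_assoc]
    _ = ((2 * (f (α * αᴴ)).re + δ * ‖α‖ ^ 2 : ℝ) : ℂ) := by
      rw [← ha, Matrix.add_mul, trace_add, trace_add_conjTranspose_mul, hρ, smul_mul,
        Matrix.one_mul, trace_smul, trace_mul_conjTranspose_self, smul_eq_mul,
        ← Complex.ofReal_mul, ← Complex.ofReal_add]

variable {V : Type*} [AddCommGroup V] [Module ℂ V] [MatrixNorms V] [RuanNorms V]
variable {F : Matrix k l V →ₗ[ℂ] ℂ}

theorem norm_le_mul_of_gramSet {a : Matrix k k ℂ} {b : Matrix l l ℂ}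
    (h : ∀ {m n : Type} [Fintype m] [Fintype n] (α : Matrix k m ℂ) (β : Matrix n l ℂ),
      (α * αᴴ, βᴴ * β) ∈ gramSet F → 2 ≤ ‖a * α‖ ^ 2 + ‖β * b‖ ^ 2)
    (α : Matrix k m ℂ) (x : Matrix m n V) (β : Matrix n l ℂ) :
    ‖F (twoSided α x β)‖ ≤ ‖a * α‖ * mnorm x * ‖β * b‖ := by
  have hnorm {p q : Type} [Fintype p] [Fintype q] {t : ℝ} {M : Matrix p q ℂ} (ht : ‖M‖ < t) :
      ‖(t : ℂ)⁻¹ • M‖ ^ 2 < 1 := by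
    have ht0 := (norm_nonneg M).trans_lt ht
    rw [norm_smul, norm_inv, Complex.norm_of_nonneg ht0.le, sq_lt_one_iff₀ (by positivity)]
    exact (inv_mul_lt_one₀ ht0).2 ht
  have hdiv (c : ℝ) (hc : mnorm x < c) : ‖F (twoSided α x β)‖ / c ≤ ‖a * α‖ * ‖β * b‖ := by
    refine le_mul_of_forall_lt₀ fun A hA B hB => ?_
    by_contra! hlt
    have h2 := h _ _ (inv_smul_mem_gramSet ((norm_nonneg _).trans_lt hA) hc
      ((norm_nonneg _).trans_lt hB) hlt.le)
    rw [Matrix.mul_smul, smul_mul] at h2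
    linarith [hnorm hA, hnorm hB]
  rw [mul_right_comm, mul_comm]
  refine le_mul_of_forall_lt₀ fun c hc d hd => ?_
  have hc0 := (mnorm_nonneg x).trans_lt hc
  exact ((div_le_iff₀' hc0).1 (hdiv c hc)).trans (mul_le_mul_of_nonneg_left hd.le hc0.le)

theorem exists_dominating_pair [DecidableEq k] [DecidableEq l] (hF : ∀ x, ‖F x‖ ≤ mnorm x)
    {C : ℝ} (hC : 1 < C) :
    ∃ (a : Matrix k k ℂ) (b : Matrix l l ℂ), IsUnit a ∧ IsUnit b ∧ ‖a‖ * ‖b‖ ≤ C ∧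
      ∀ {m n : Type} [Fintype m] [Fintype n] (α : Matrix k m ℂ) (x : Matrix m n V)
        (β : Matrix n l ℂ), ‖F (twoSided α x β)‖ ≤ ‖a * α‖ * mnorm x * ‖β * b‖ := by
  obtain ⟨f, g, hf, hg, hfg, hmem⟩ := exists_positive_functionals hF
  set s := ‖(1 : Matrix k k ℂ)‖ ^ 2 + ‖(1 : Matrix l l ℂ)‖ ^ 2
  obtain ⟨δ, hδ, hδs⟩ : ∃ δ > 0, δ * s ≤ 2 * (C - 1) := by
    have := sub_pos.2 hC
    refine ⟨2 * (C - 1) / (s + 1), by positivity, ?_⟩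
    rw [div_mul_eq_mul_div]
    exact div_le_of_le_mul₀ (by positivity) (by positivity) (by gcongr; linarith)
  obtain ⟨a, ha, haf⟩ := exists_density hf hδ
  obtain ⟨b, hb, hbg⟩ := exists_density hg hδ
  have hbg' {n : Type} [Fintype n] (β : Matrix n l ℂ) :
      ‖β * bᴴ‖ ^ 2 = 2 * (g (βᴴ * β)).re + δ * ‖β‖ ^ 2 := by
    have h := hbg βᴴ
    rwa [conjTranspose_conjTranspose, frobenius_norm_conjTranspose,
      ← frobenius_norm_conjTranspose, conjTranspose_mul, conjTranspose_conjTranspose] at h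
  refine ⟨a, bᴴ, ha, hb.star, ?_, norm_le_mul_of_gramSet fun α β hαβ => ?_⟩
  · have h1 := haf (1 : Matrix k k ℂ)
    have h2 := hbg' (1 : Matrix l l ℂ)
    rw [conjTranspose_one, Matrix.mul_one, Matrix.mul_one] at h1
    rw [conjTranspose_one, Matrix.mul_one, Matrix.one_mul] at h2
    nlinarith [sq_nonneg (‖a‖ - ‖bᴴ‖)]
  · rw [haf, hbg']
    have := hmem _ hαβ
    have h1 := mul_nonneg hδ.le (sq_nonneg ‖α‖)
    have h2 := mul_nonneg hδ.le (sq_nonneg ‖β‖)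
    linarith

/-- The matrix `f` of functionals, as a map `V → M_{m,n}`, has completely bounded norm at most `C`.
The operator norm of `[f_{ij}(x_{pq})]` is expressed by the values at pairs of vectors, which are
regarded as Hilbert–Schmidt matrices `α` and `β`. -/
def CBBound (f : Matrix m n (Module.Dual ℂ V)) (C : ℝ) : Prop :=
  ∀ ⦃k l : Type⦄ [Fintype k] [Fintype l] (α : Matrix m k ℂ) (x : Matrix k l V) (β : Matrix l n ℂ),
    ‖pair f (twoSided α x β)‖ ≤ C * (‖α‖ * mnorm x * ‖β‖)

theorem exists_cb_factorization (hF : ∀ x, ‖F x‖ ≤ mnorm x) {C : ℝ} (hC : 1 < C) :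
    ∃ (g : Matrix k l (Module.Dual ℂ V)) (a : Matrix k k ℂ) (b : Matrix l l ℂ),
      CBBound g 1 ∧ ‖a‖ * ‖b‖ ≤ C ∧ ∀ x, F x = pair g (twoSided a x b) := by
  classical
  obtain ⟨a, b, ha, hb, hab, hbound⟩ := exists_dominating_pair hF hC
  rw [isUnit_iff_isUnit_det] at ha hb
  obtain ⟨f, rfl⟩ := exists_pair_eq F
  have hg {x : Matrix k l V} : pair (twoSided (a⁻¹)ᵀ f (b⁻¹)ᵀ) x = pair f (twoSided a⁻¹ x b⁻¹) :=
    (pair_twoSided f _ x _).symm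
  refine ⟨twoSided (a⁻¹)ᵀ f (b⁻¹)ᵀ, a, b, fun p q _ _ α x β => ?_, hab, fun x => ?_⟩
  · rw [hg, twoSided_twoSided, one_mul]
    simpa only [mul_nonsing_inv_cancel_left _ _ ha, nonsing_inv_mul_cancel_right _ _ hb] using
      hbound (a⁻¹ * α) x (β * b⁻¹)
  · rw [hg, twoSided_twoSided, nonsing_inv_mul _ ha, mul_nonsing_inv _ hb, twoSided_one]

theorem exists_norming_functional (x : Matrix k l V) :
    ∃ F : Matrix k l V →ₗ[ℂ] ℂ, (∀ y, ‖F y‖ ≤ mnorm y) ∧ F x = mnorm x := by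
  let p : Seminorm ℂ (Matrix k l V) := .of mnorm mnorm_add_le mnorm_smul
  rcases eq_or_ne x 0 with rfl | hx
  · exact ⟨0, fun y => by simpa using mnorm_nonneg y, by simp⟩
  let e := LinearEquiv.toSpanNonzeroSingleton ℂ (Matrix k l V) x hx
  obtain ⟨F, hFe, hF⟩ := Module.Dual.exists_extension_of_le_seminorm (Submodule.span ℂ {x})
    ((mnorm x : ℂ) • (e.symm : _ →ₗ[ℂ] ℂ)) (p := p) fun y => by
      obtain ⟨c, rfl⟩ := e.surjective y
      change _ ≤ mnorm (c • x)
      simp [mnorm_smul, abs_of_nonneg (mnorm_nonneg x), mul_comm]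
  refine ⟨F, hF, ?_⟩
  calc F x = F (e 1) := by simp [e]
    _ = mnorm x * e.symm (e 1) := hFe (e 1)
    _ = mnorm x := by rw [e.symm_apply_apply, mul_one]

theorem mnorm_le_of_forall_pair {y : Matrix k l V} {C : ℝ} (hC : 0 ≤ C)
    (h : ∀ g : Matrix k l (Module.Dual ℂ V), CBBound g 1 → ∀ (α : Matrix k k ℂ) (β : Matrix l l ℂ),
      ‖pair g (twoSided α y β)‖ ≤ C * (‖α‖ * ‖β‖)) : mnorm y ≤ C := by
  obtain ⟨F, hF, hFy⟩ := exists_norming_functional y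
  rw [← mul_one C]
  refine le_mul_of_forall_lt₀ fun D hD K hK => ?_
  obtain ⟨g, a, b, hg, hab, hfac⟩ := exists_cb_factorization hF hK
  calc mnorm y = ‖pair g (twoSided a y b)‖ := by
        rw [← hfac, hFy, Complex.norm_of_nonneg (mnorm_nonneg y)]
    _ ≤ C * (‖a‖ * ‖b‖) := h g hg a b
    _ ≤ D * K := mul_le_mul hD.le hab (by positivity) (hC.trans hD.le)

end Factorization

/-! ### Operator spaces -/

section OperatorSpace

theorem mul_mul_le_of_le_one {a b c : ℝ} (ha : a ≤ 1) (hc : 0 ≤ c) (hb₀ : 0 ≤ b) (hb : b ≤ 1) :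
    a * c * b ≤ c :=
  (mul_le_mul_of_nonneg_right (mul_le_of_le_one_left hc ha) hb₀).trans
    (mul_le_of_le_one_right hc hb)

open OperatorSpace (matNorm)

variable {X : Type*} [NormedAddCommGroup X] [NormedSpace ℂ X] [OperatorSpace X]
variable {m n : Type} [Fintype m] [Fintype n] {r : ℕ}

theorem matNorm_nonneg (x : Matrix (Fin r) (Fin r) X) : 0 ≤ matNorm x :=
  apply_nonneg (Seminorm.of matNorm OperatorSpace.matNorm_add_le OperatorSpace.matNorm_smul) x

theorem exists_twoSided_matNorm (x : Matrix m n X) :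
    ∃ (r : ℕ) (z : Matrix (Fin r) (Fin r) X) (α : Matrix m (Fin r) ℂ) (β : Matrix (Fin r) n ℂ),
      matNorm z = mnorm x ∧ scalarNorm α ≤ 1 ∧ scalarNorm β ≤ 1 ∧ twoSided α z β = x := by
  let e := Fintype.equivFin (m ⊕ n)
  refine ⟨_, reindex e e (fromBlocks 0 x 0 0), (1 : Matrix _ _ ℂ).submatrix (e ∘ Sum.inl) id,
    (1 : Matrix _ _ ℂ).submatrix id (e ∘ Sum.inr), rfl,
    scalarNorm_submatrix_one_le (e.injective.comp Sum.inl_injective),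
    scalarNorm_submatrix_one_right_le (e.injective.comp Sum.inr_injective), ?_⟩
  rw [twoSided_submatrix_one]
  ext i j
  simp

theorem mnorm_twoSided_le_matNorm (α : Matrix m (Fin r) ℂ) (x : Matrix (Fin r) (Fin r) X)
    (β : Matrix (Fin r) n ℂ) :
    mnorm (twoSided α x β) ≤ scalarNorm α * matNorm x * scalarNorm β := by
  classical
  let e := Fintype.equivFin (m ⊕ n)
  let R := Fin (Fintype.card (m ⊕ n))
  let E : Matrix R m ℂ := (1 : Matrix R R ℂ).submatrix id (e ∘ Sum.inl)
  let F : Matrix n R ℂ := (1 : Matrix R R ℂ).submatrix (e ∘ Sum.inr) id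
  have h (y : Matrix m n X) : reindex e e (fromBlocks 0 y 0 0) = twoSided E y F := by
    ext i j
    obtain ⟨i, rfl⟩ := e.surjective i
    obtain ⟨j, rfl⟩ := e.surjective j
    rcases i with i | i <;> rcases j with j | j <;> simp [E, F, twoSided, one_apply]
  have hα : scalarNorm (E * α) ≤ scalarNorm α :=
    (scalarNorm_mul_le E α).trans <| mul_le_of_le_one_left (scalarNorm_nonneg α)
      (scalarNorm_submatrix_one_right_le (e.injective.comp Sum.inl_injective))
  have hβ : scalarNorm (β * F) ≤ scalarNorm β :=
    (scalarNorm_mul_le β F).trans <| mul_le_of_le_one_right (scalarNorm_nonneg β)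
      (scalarNorm_submatrix_one_le (e.injective.comp Sum.inr_injective))
  calc mnorm (twoSided α x β) = matNorm (twoSided (E * α) x (β * F)) := by
        rw [← twoSided_twoSided, ← h]; rfl
    _ ≤ scalarNorm (E * α) * matNorm x * scalarNorm (β * F) :=
        OperatorSpace.matNorm_twoSided_le _ x _
    _ ≤ scalarNorm α * matNorm x * scalarNorm β := by
        gcongr
        exacts [scalarNorm_nonneg _, mul_nonneg (scalarNorm_nonneg _) (matNorm_nonneg x),
          matNorm_nonneg x]

theorem mnorm_eq_matNorm (x : Matrix (Fin r) (Fin r) X) : mnorm x = matNorm x := by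
  refine le_antisymm ?_ ?_
  · have h := mnorm_twoSided_le_matNorm (1 : Matrix (Fin r) _ ℂ) x (1 : Matrix _ (Fin r) ℂ)
    rw [twoSided_one] at h
    exact h.trans (mul_mul_le_of_le_one scalarNorm_one_le (matNorm_nonneg x)
      (scalarNorm_nonneg _) scalarNorm_one_le)
  · obtain ⟨R, z, α, β, hz, hα, hβ, hx⟩ := exists_twoSided_matNorm x
    calc matNorm x = matNorm (twoSided α z β) := by rw [hx]
      _ ≤ scalarNorm α * matNorm z * scalarNorm β := OperatorSpace.matNorm_twoSided_le α z β
      _ ≤ matNorm z :=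
          mul_mul_le_of_le_one hα (matNorm_nonneg z) (scalarNorm_nonneg β) hβ
      _ = mnorm x := hz

instance : RuanNorms X where
  mnorm_nonneg x := matNorm_nonneg _
  mnorm_twoSided_le α x β := by
    obtain ⟨r, z, α', β', hz, hα, hβ, rfl⟩ := exists_twoSided_matNorm x
    rw [twoSided_twoSided, ← hz]
    refine (mnorm_twoSided_le_matNorm _ z _).trans ?_
    have hα' : scalarNorm (α * α') ≤ scalarNorm α :=
      (scalarNorm_mul_le α α').trans (mul_le_of_le_one_right (scalarNorm_nonneg α) hα)
    have hβ' : scalarNorm (β' * β) ≤ scalarNorm β :=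
      (scalarNorm_mul_le β' β).trans (mul_le_of_le_one_left (scalarNorm_nonneg β) hβ)
    exact mul_le_mul (mul_le_mul_of_nonneg_right hα' (matNorm_nonneg z)) hβ' (scalarNorm_nonneg _)
      (mul_nonneg (scalarNorm_nonneg α) (matNorm_nonneg z))
  mnorm_fromBlocks_le x y := by
    obtain ⟨r, z, α, β, hz, hα, hβ, rfl⟩ := exists_twoSided_matNorm x
    obtain ⟨r', z', α', β', hz', hα', hβ', rfl⟩ := exists_twoSided_matNorm y
    let e : Fin r ⊕ Fin r' ≃ Fin (r + r') := finSumFinEquiv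
    let R := Fin (r + r')
    let E : Matrix (Fin r ⊕ Fin r') R ℂ := (1 : Matrix R R ℂ).submatrix e id
    let F : Matrix R (Fin r ⊕ Fin r') ℂ := (1 : Matrix R R ℂ).submatrix id e
    let w := reindex e e (fromBlocks z 0 0 z')
    have hw : fromBlocks z 0 0 z' = twoSided E w F := by
      rw [twoSided_submatrix_one]
      simp [w]
    have hα : scalarNorm (fromBlocks α 0 0 α' * E) ≤ 1 :=
      (scalarNorm_mul_le _ E).trans <| mul_le_one₀
        ((scalarNorm_fromBlocks_le α α').trans (max_le hα hα')) (scalarNorm_nonneg E)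
        (scalarNorm_submatrix_one_le e.injective)
    have hβ : scalarNorm (F * fromBlocks β 0 0 β') ≤ 1 :=
      (scalarNorm_mul_le F _).trans <| mul_le_one₀ (scalarNorm_submatrix_one_right_le e.injective)
        (scalarNorm_nonneg _) ((scalarNorm_fromBlocks_le β β').trans (max_le hβ hβ'))
    rw [← twoSided_fromBlocks, hw, twoSided_twoSided, ← hz, ← hz',
      ← OperatorSpace.matNorm_directSum]
    exact (mnorm_twoSided_le_matNorm _ w _).trans
      (mul_mul_le_of_le_one hα (matNorm_nonneg w) (scalarNorm_nonneg _) hβ)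

theorem elemNorm_eq_norm (x : X) : elemNorm x = ‖x‖ :=
  (mnorm_eq_matNorm _).trans (OperatorSpace.matNorm_one x)

end OperatorSpace

/-! ### The dual operator space -/

section CBBound

open scoped Matrix.Norms.Frobenius

variable {V : Type*} [AddCommGroup V] [Module ℂ V]
variable {m n k l : Type} [Fintype m] [Fintype n] [Fintype k] [Fintype l]

/-- The scalar matrix `[f_{ij}(x_{pq})]`, indexed as in the definition of the norm of `M_{m,n}(X*)`:
the value at `x` of the amplified map `x ↦ [f_{ij}(x)]`. -/
def amplify (f : Matrix m n (Module.Dual ℂ V)) (x : Matrix k l V) : Matrix (k × m) (l × n) ℂ :=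
  of fun a b => f a.2 b.2 (x a.1 b.1)

theorem pair_twoSided_eq_dotProduct (f : Matrix m n (Module.Dual ℂ V)) (α : Matrix m k ℂ)
    (x : Matrix k l V) (β : Matrix l n ℂ) :
    pair f (twoSided α x β) = vec α ⬝ᵥ amplify f x *ᵥ vec βᵀ := by
  simp only [pair_apply, twoSided_apply, map_sum, map_smul, smul_eq_mul]
  rw [Finset.sum_comm]
  simp only [dotProduct, mulVec, Fintype.sum_prod_type, Finset.mul_sum, amplify, of_apply, vec,
    transpose_apply]
  refine Finset.sum_congr rfl fun p _ => ?_
  rw [Finset.sum_comm]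
  exact Finset.sum_congr rfl fun i _ => Finset.sum_congr rfl fun q _ =>
    Finset.sum_congr rfl fun j _ => by ring

variable [MatrixNorms V] {f : Matrix m n (Module.Dual ℂ V)} {C : ℝ}

theorem cbBound_of_forall_lt (h : ∀ D, C < D → CBBound f D) : CBBound f C :=
  fun _ _ _ _ α x β => ge_of_tendsto
    ((continuous_mul_const _).continuousWithinAt (s := Set.Ioi C))
    (eventually_mem_nhdsWithin.mono fun D hD => h D hD α x β)

theorem CBBound.norm_apply_le (h : CBBound f C) (i : m) (j : n) (x : V) :
    ‖f i j x‖ ≤ C * elemNorm x := by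
  classical
  let α : Matrix m (Fin 1) ℂ := (1 : Matrix m m ℂ).submatrix id fun _ => i
  let β : Matrix (Fin 1) n ℂ := (1 : Matrix n n ℂ).submatrix (fun _ => j) id
  have hα : ‖α‖ = 1 := by
    rw [← sq_eq_sq₀ (norm_nonneg α) zero_le_one, frobenius_norm_sq]
    simp [α, one_apply, apply_ite]
  have hβ : ‖β‖ = 1 := by
    rw [← sq_eq_sq₀ (norm_nonneg β) zero_le_one, frobenius_norm_sq]
    simp [β, one_apply, apply_ite]
  have hpair : pair f (twoSided α (of fun _ _ => x) β) = f i j x := by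
    rw [pair_twoSided, transpose_submatrix, transpose_submatrix, transpose_one, transpose_one,
      twoSided_submatrix_one]
    simp [pair_apply]
  simpa [hpair, hα, hβ, elemNorm] using h α (of fun _ _ => x) β

omit [MatrixNorms V] in
theorem exists_square_dilation (x : Matrix k l V) :
    ∃ (r : ℕ) (α : Matrix k (Fin r) ℂ) (α' : Matrix (Fin r) k ℂ) (β' : Matrix l (Fin r) ℂ)
      (β : Matrix (Fin r) l ℂ), scalarNorm α ≤ 1 ∧ scalarNorm α' ≤ 1 ∧ scalarNorm β' ≤ 1 ∧
        scalarNorm β ≤ 1 ∧ twoSided α (twoSided α' x β') β = x := by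
  classical
  let e := Fintype.equivFin (k ⊕ l)
  let R := Fin (Fintype.card (k ⊕ l))
  have hk : Function.Injective (e ∘ Sum.inl) := e.injective.comp Sum.inl_injective
  have hl : Function.Injective (e ∘ Sum.inr) := e.injective.comp Sum.inr_injective
  have hmul {p : Type} [DecidableEq p] {g : p → R} (hg : Function.Injective g) :
      (1 : Matrix R R ℂ).submatrix g id * (1 : Matrix R R ℂ).submatrix id g = 1 := by
    rw [← submatrix_mul _ _ _ _ _ Function.bijective_id, Matrix.one_mul, submatrix_one _ hg]
  refine ⟨_, (1 : Matrix R R ℂ).submatrix (e ∘ Sum.inl) id,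
    (1 : Matrix R R ℂ).submatrix id (e ∘ Sum.inl), (1 : Matrix R R ℂ).submatrix (e ∘ Sum.inr) id,
    (1 : Matrix R R ℂ).submatrix id (e ∘ Sum.inr), scalarNorm_submatrix_one_le hk,
    scalarNorm_submatrix_one_right_le hk, scalarNorm_submatrix_one_le hl,
    scalarNorm_submatrix_one_right_le hl, ?_⟩
  rw [twoSided_twoSided, hmul hk, hmul hl, twoSided_one]

variable [RuanNorms V]

theorem exists_square (x : Matrix k l V) :
    ∃ (r : ℕ) (z : Matrix (Fin r) (Fin r) V) (α : Matrix k (Fin r) ℂ) (β : Matrix (Fin r) l ℂ),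
      mnorm z ≤ mnorm x ∧ scalarNorm α ≤ 1 ∧ scalarNorm β ≤ 1 ∧ twoSided α z β = x := by
  obtain ⟨r, α, α', β', β, hα, hα', hβ', hβ, h⟩ := exists_square_dilation x
  exact ⟨r, _, α, β, mnorm_twoSided_le_of_le_one x hα' hβ', hα, hβ, h⟩

theorem CBBound.mono {D : ℝ} (h : CBBound f C) (hCD : C ≤ D) : CBBound f D :=
  fun _ _ _ _ α x β => (h α x β).trans (mul_le_mul_of_nonneg_right hCD (mul_nonneg
    (mul_nonneg (norm_nonneg α) (mnorm_nonneg x)) (norm_nonneg β)))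

theorem cbBound_of_square
    (h : ∀ (r : ℕ) (α : Matrix m (Fin r) ℂ) (x : Matrix (Fin r) (Fin r) V)
      (β : Matrix (Fin r) n ℂ), ‖pair f (twoSided α x β)‖ ≤ C * (‖α‖ * mnorm x * ‖β‖))
    (hC : 0 ≤ C) : CBBound f C := by
  intro k l _ _ α x β
  obtain ⟨r, z, a, b, hz, ha, hb, rfl⟩ := exists_square x
  rw [twoSided_twoSided]
  refine (h r _ z _).trans (mul_le_mul_of_nonneg_left ?_ hC)
  have hα : ‖α * a‖ ≤ ‖α‖ :=
    (norm_mul_le_mul_scalarNorm α a).trans (mul_le_of_le_one_right (norm_nonneg α) ha)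
  have hβ : ‖b * β‖ ≤ ‖β‖ :=
    (norm_mul_le_scalarNorm_mul b β).trans (mul_le_of_le_one_left (norm_nonneg β) hb)
  have := mnorm_nonneg z
  gcongr
  exact mul_nonneg (norm_nonneg α) (this.trans hz)

theorem cbBound_iff_scalarNorm_amplify (hC : 0 ≤ C) :
    CBBound f C ↔ ∀ (r : ℕ) (x : Matrix (Fin r) (Fin r) V),
      scalarNorm (amplify f x) ≤ C * mnorm x := by
  constructor
  · intro h r x
    refine (scalarNorm_le_iff (mul_nonneg hC (mnorm_nonneg x))).2 fun u v => ?_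
    obtain ⟨α, rfl⟩ : ∃ α : Matrix m (Fin r) ℂ, vec α = u := ⟨of fun i p => u (p, i), rfl⟩
    obtain ⟨β, rfl⟩ : ∃ β : Matrix (Fin r) n ℂ, vec βᵀ = v := ⟨of fun q j => v (q, j), rfl⟩
    rw [← pair_twoSided_eq_dotProduct, norm_toLp_vec, norm_toLp_vec, frobenius_norm_transpose]
    exact (h α x β).trans_eq (by ring)
  · refine fun h => cbBound_of_square (fun r α x β => ?_) hC
    rw [pair_twoSided_eq_dotProduct]
    refine ((scalarNorm_le_iff (mul_nonneg hC (mnorm_nonneg x))).1 (h r x) _ _).trans_eq ?_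
    rw [norm_toLp_vec, norm_toLp_vec, frobenius_norm_transpose]
    ring

theorem CBBound.fromBlocks {m' n' : Type} [Fintype m'] [Fintype n'] (hf : CBBound f C)
    {g : Matrix m' n' (Module.Dual ℂ V)} (hg : CBBound g C) (hC : 0 ≤ C) :
    CBBound (fromBlocks f 0 0 g) C := by
  intro k l _ _ α x β
  have hα : ‖α‖ ^ 2 = ‖α.toRows₁‖ ^ 2 + ‖α.toRows₂‖ ^ 2 := by
    simp [frobenius_norm_sq, Fintype.sum_sum_type]
  have hβ : ‖β‖ ^ 2 = ‖β.toCols₁‖ ^ 2 + ‖β.toCols₂‖ ^ 2 := by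
    simp [frobenius_norm_sq, Fintype.sum_sum_type, Finset.sum_add_distrib]
  have hαβ : ‖α.toRows₁‖ * ‖β.toCols₁‖ + ‖α.toRows₂‖ * ‖β.toCols₂‖ ≤ ‖α‖ * ‖β‖ := by
    refine le_of_sq_le_sq ?_ (by positivity)
    rw [mul_pow, hα, hβ]
    linarith [sq_nonneg (‖α.toRows₁‖ * ‖β.toCols₂‖ - ‖α.toRows₂‖ * ‖β.toCols₁‖)]
  have hx := mnorm_nonneg x
  rw [pair_fromBlocks]
  calc _ ≤ C * (‖α.toRows₁‖ * mnorm x * ‖β.toCols₁‖) + C * (‖α.toRows₂‖ * mnorm x * ‖β.toCols₂‖) :=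
        norm_add_le_of_le (hf α.toRows₁ x β.toCols₁) (hg α.toRows₂ x β.toCols₂)
    _ = C * mnorm x * (‖α.toRows₁‖ * ‖β.toCols₁‖ + ‖α.toRows₂‖ * ‖β.toCols₂‖) := by ring
    _ ≤ C * mnorm x * (‖α‖ * ‖β‖) := by gcongr
    _ = C * (‖α‖ * mnorm x * ‖β‖) := by ring

end CBBound

section Dual

open scoped Matrix.Norms.Frobenius

variable {X : Type*} [NormedAddCommGroup X] [NormedSpace ℂ X]
variable {m n k l : Type}

/-- The matrix of algebraic functionals underlying a matrix of bounded functionals. -/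
def toDual (f : Matrix m n (StrongDual ℂ X)) : Matrix m n (Module.Dual ℂ X) :=
  f.map (ContinuousLinearMap.coeLM ℂ)

theorem toDual_injective : Function.Injective (toDual : Matrix m n (StrongDual ℂ X) → _) :=
  Matrix.map_injective ContinuousLinearMap.coe_injective

variable [Fintype k] [Fintype l]

theorem toDual_twoSided (α : Matrix m k ℂ) (f : Matrix k l (StrongDual ℂ X)) (β : Matrix l n ℂ) :
    toDual (twoSided α f β) = twoSided α (toDual f) β :=
  map_twoSided _ α f β

variable [OperatorSpace X] [Fintype m] [Fintype n]

theorem cbBound_toDual (f : Matrix m n (StrongDual ℂ X)) :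
    CBBound (toDual f) (∑ p : m × n, ‖f p.1 p.2‖) := by
  intro k l _ _ α x β
  have hentry (i : m) (j : n) : ‖twoSided α x β i j‖ ≤ ‖α‖ * mnorm x * ‖β‖ :=
    calc ‖twoSided α x β i j‖ = mnorm ((twoSided α x β).submatrix (fun _ : Fin 1 => i)
          (fun _ : Fin 1 => j)) := (elemNorm_eq_norm _).symm
      _ ≤ mnorm (twoSided α x β) := mnorm_submatrix_le _ (Function.injective_of_subsingleton _)
          (Function.injective_of_subsingleton _)
      _ ≤ ‖α‖ * mnorm x * ‖β‖ :=
          mnorm_twoSided_le_of_le (scalarNorm_le_norm α) le_rfl (scalarNorm_le_norm β)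
  rw [pair_apply, Finset.sum_mul]
  exact norm_sum_le_of_le _ fun p _ => ((f p.1 p.2).le_opNorm _).trans
    (mul_le_mul_of_nonneg_left (hentry _ _) (norm_nonneg _))

theorem mnorm_eq_sInf (f : Matrix m n (StrongDual ℂ X)) :
    mnorm f = sInf {C : ℝ | 0 ≤ C ∧ CBBound (toDual f) C} := by
  have h : mnorm f = sInf {C : ℝ | 0 ≤ C ∧ ∀ (r : ℕ) (x : Matrix (Fin r) (Fin r) X),
      scalarNorm (amplify (toDual f) x) ≤ C * mnorm x} := rfl
  rw [h]
  congr 1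
  ext C
  exact and_congr_right fun hC => (cbBound_iff_scalarNorm_amplify hC).symm

theorem mnorm_le_iff_cbBound {f : Matrix m n (StrongDual ℂ X)} {C : ℝ} (hC : 0 ≤ C) :
    mnorm f ≤ C ↔ CBBound (toDual f) C := by
  rw [mnorm_eq_sInf]
  refine ⟨fun h => cbBound_of_forall_lt fun D hD => ?_,
    fun h => csInf_le ⟨0, fun _ h => h.1⟩ ⟨hC, h⟩⟩
  have hne : {C : ℝ | 0 ≤ C ∧ CBBound (toDual f) C}.Nonempty :=
    ⟨_, Finset.sum_nonneg fun p _ => norm_nonneg _, cbBound_toDual f⟩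
  obtain ⟨E, hE, hED⟩ := exists_lt_of_csInf_lt hne (h.trans_lt hD)
  exact hE.2.mono hED.le

theorem mnorm_dual_nonneg (f : Matrix m n (StrongDual ℂ X)) : 0 ≤ mnorm f :=
  Real.sInf_nonneg fun _ h => h.1

theorem cbBound_mnorm (f : Matrix m n (StrongDual ℂ X)) : CBBound (toDual f) (mnorm f) :=
  (mnorm_le_iff_cbBound (mnorm_dual_nonneg f)).1 le_rfl

theorem exists_toDual_eq {g : Matrix m n (Module.Dual ℂ X)} {C : ℝ} (hC : 0 ≤ C)
    (hg : CBBound g C) : ∃ f : Matrix m n (StrongDual ℂ X), toDual f = g ∧ mnorm f ≤ C := by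
  let f : Matrix m n (StrongDual ℂ X) := of fun i j => (g i j).mkContinuous C fun x =>
    elemNorm_eq_norm x ▸ hg.norm_apply_le i j x
  have hf : toDual f = g := rfl
  exact ⟨f, hf, (mnorm_le_iff_cbBound hC).2 (hf ▸ hg)⟩

instance : RuanNorms (StrongDual ℂ X) where
  mnorm_nonneg := mnorm_dual_nonneg
  mnorm_twoSided_le γ f δ := by
    have hγ := scalarNorm_nonneg γ
    have hδ := scalarNorm_nonneg δ
    have hf := mnorm_dual_nonneg f
    refine (mnorm_le_iff_cbBound (by positivity)).2 fun k l _ _ α x β => ?_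
    have hx := mnorm_nonneg x
    have h : pair (toDual (twoSided γ f δ)) (twoSided α x β) =
        pair (toDual f) (twoSided (γᵀ * α) x (β * δᵀ)) := by
      rw [toDual_twoSided, ← twoSided_twoSided, pair_twoSided (toDual f), transpose_transpose,
        transpose_transpose]
    calc ‖pair (toDual (twoSided γ f δ)) (twoSided α x β)‖
        ≤ mnorm f * (‖γᵀ * α‖ * mnorm x * ‖β * δᵀ‖) := h ▸ cbBound_mnorm f _ _ _
      _ ≤ mnorm f * (scalarNorm γ * ‖α‖ * mnorm x * (‖β‖ * scalarNorm δ)) := by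
          grw [norm_mul_le_scalarNorm_mul, norm_mul_le_mul_scalarNorm, scalarNorm_transpose,
            scalarNorm_transpose]
          rw [scalarNorm_transpose]
          positivity
      _ = scalarNorm γ * mnorm f * scalarNorm δ * (‖α‖ * mnorm x * ‖β‖) := by ring
  mnorm_fromBlocks_le f g := by
    have h0 := (mnorm_dual_nonneg f).trans (le_max_left _ (mnorm g))
    have h : toDual (fromBlocks f 0 0 g) = fromBlocks (toDual f) 0 0 (toDual g) := by
      ext (i | i) (j | j) <;> rfl
    rw [mnorm_le_iff_cbBound h0, h]
    exact ((cbBound_mnorm f).mono (le_max_left _ _)).fromBlocks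
      ((cbBound_mnorm g).mono (le_max_right _ _)) h0

end Dual

/-! ### Matrix spaces and the projective tensor product -/

section Matrix

open scoped TensorProduct Kronecker

variable {V : Type*} [AddCommGroup V] [Module ℂ V]

theorem twoSided_eq_mul {m n k l : Type} [Fintype k] [Fintype l] (α : Matrix m k ℂ)
    (A : Matrix k l ℂ) (β : Matrix l n ℂ) : twoSided α A β = α * A * β := by
  ext i j
  simp only [twoSided, of_apply, mul_apply, smul_eq_mul, Finset.sum_mul]
  rw [Finset.sum_comm]
  exact Finset.sum_congr rfl fun q _ => Finset.sum_congr rfl fun p _ => by ring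

instance : RuanNorms ℂ where
  mnorm_nonneg A := scalarNorm_nonneg A
  mnorm_twoSided_le α A β := by
    rw [twoSided_eq_mul]
    exact (scalarNorm_mul_le _ β).trans
      (mul_le_mul_of_nonneg_right (scalarNorm_mul_le α A) (scalarNorm_nonneg β))
  mnorm_fromBlocks_le A B := scalarNorm_fromBlocks_le A B

theorem scalarNorm_kronecker_one_le {m n p : Type} [Fintype m] [Fintype n] [Fintype p]
    [DecidableEq p] (A : Matrix m n ℂ) : scalarNorm (A ⊗ₖ (1 : Matrix p p ℂ)) ≤ scalarNorm A :=
  (scalarNorm_kronecker_le A 1).trans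
    (mul_le_of_le_one_right (scalarNorm_nonneg A) scalarNorm_one_le)

theorem comp_twoSided {m n k l p q : Type} [Fintype k] [Fintype l] [Fintype p] [Fintype q]
    [DecidableEq p] [DecidableEq q] (α : Matrix m k ℂ) (x : Matrix k l (Matrix p q V))
    (β : Matrix l n ℂ) :
    comp m n p q V (twoSided α x β) = twoSided (α ⊗ₖ 1) (comp k l p q V x) (β ⊗ₖ 1) := by
  ext ⟨i, p⟩ ⟨j, q⟩
  simp [twoSided, Matrix.sum_apply, Fintype.sum_prod_type, one_apply]

variable [MatrixNorms V] [RuanNorms V]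

instance {p q : Type} [Fintype p] [Fintype q] : RuanNorms (Matrix p q V) where
  mnorm_nonneg x := mnorm_nonneg (V := V) _
  mnorm_twoSided_le {m n k l} _ _ _ _ α x β := by
    classical
    change mnorm (comp m n p q V _) ≤ scalarNorm α * mnorm (comp k l p q V x) * scalarNorm β
    rw [comp_twoSided]
    exact mnorm_twoSided_le_of_le (scalarNorm_kronecker_one_le α) le_rfl
      (scalarNorm_kronecker_one_le β)
  mnorm_fromBlocks_le {m n k l} _ _ _ _ x y := by
    have h : comp _ _ p q V (fromBlocks x 0 0 y) =
        (fromBlocks (comp m n p q V x) 0 0 (comp k l p q V y)).submatrix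
          (Equiv.sumProdDistrib m k p) (Equiv.sumProdDistrib n l q) := by
      ext ⟨i | i, p⟩ ⟨j | j, q⟩ <;> rfl
    change mnorm (comp _ _ p q V _) ≤ _
    rw [h, mnorm_submatrix_equiv]
    exact mnorm_fromBlocks_le _ _

theorem mnorm_blockDiagonal_le {p k l : Type} [Fintype p] [DecidableEq p] [Fintype k] [Fintype l]
    {M : p → Matrix k l V} {C : ℝ} (hC : 0 ≤ C) (hM : ∀ i, mnorm (M i) ≤ C) :
    mnorm (blockDiagonal M) ≤ C := by
  suffices h : ∀ (p : Type) [Fintype p], ∀ [DecidableEq p] (M : p → Matrix k l V),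
      (∀ i, mnorm (M i) ≤ C) → mnorm (blockDiagonal M) ≤ C from h p M hM
  refine Fintype.induction_empty_option (fun p q _ e ih => ?_) (fun M _ => ?_) (fun p _ ih => ?_)
  · intro _ M hM
    classical
    let := Fintype.ofEquiv q e.symm
    have h : blockDiagonal M = (blockDiagonal (M ∘ e)).submatrix
        ((Equiv.refl k).prodCongr e.symm) ((Equiv.refl l).prodCongr e.symm) := by
      ext ⟨i, a⟩ ⟨j, b⟩
      simp [blockDiagonal_apply]
    rw [h, mnorm_submatrix_equiv]
    exact ih (M ∘ e) fun i => hM (e i)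
  · rwa [show blockDiagonal M = 0 from Matrix.ext fun i => i.2.elim, mnorm_zero]
  · intro _ M hM
    classical
    let e (q : Type) : q × Option p ≃ q × p ⊕ q :=
      (Equiv.prodCongr (Equiv.refl q) (Equiv.optionEquivSumPUnit p)).trans
        ((Equiv.prodSumDistrib q p PUnit.{1}).trans
          (Equiv.sumCongr (Equiv.refl _) (Equiv.prodPUnit q)))
    have h : blockDiagonal M = (fromBlocks (blockDiagonal fun i => M (some i)) 0 0
        (M none)).submatrix (e k) (e l) := by
      ext ⟨i, _ | a⟩ ⟨j, _ | b⟩ <;> simp [blockDiagonal_apply, e]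
    rw [h, mnorm_submatrix_equiv]
    exact (mnorm_fromBlocks_le _ _).trans (max_le (ih _ fun i => hM (some i)) (hM none))

end Matrix

section Tensor

open scoped TensorProduct Kronecker

variable {V W : Type*} [AddCommGroup V] [Module ℂ V] [AddCommGroup W] [Module ℂ W]
variable {m n k l p q k' l' p' q' : Type}

theorem fromBlocks_kroneckerTMul (v : Matrix k l V) (w : Matrix p q W) (v' : Matrix k' l' V)
    (w' : Matrix p' q' W) :
    fromBlocks (v ⊗ₖₜ[ℂ] w) 0 0 (v' ⊗ₖₜ[ℂ] w') =
      (fromBlocks v 0 0 v' ⊗ₖₜ[ℂ] fromBlocks w 0 0 w').submatrix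
        (Sum.elim (Prod.map .inl .inl) (Prod.map .inr .inr))
        (Sum.elim (Prod.map .inl .inl) (Prod.map .inr .inr)) := by
  ext (i | i) (j | j) <;> simp

theorem injective_sumElim_map_inl_inr : Function.Injective (Sum.elim (Prod.map Sum.inl Sum.inl)
    (Prod.map Sum.inr Sum.inr) : k × p ⊕ k' × p' → (k ⊕ k') × (p ⊕ p')) := by
  rintro (⟨i, j⟩ | ⟨i, j⟩) (⟨i', j'⟩ | ⟨i', j'⟩) <;> simp

variable [Fintype k] [Fintype l] [Fintype p] [Fintype q]

theorem kroneckerTMul_twoSided (a : Matrix k' k ℂ) (v : Matrix k l V)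
    (b : Matrix l l' ℂ) (c : Matrix p' p ℂ) (w : Matrix p q W) (d : Matrix q q' ℂ) :
    twoSided a v b ⊗ₖₜ[ℂ] twoSided c w d = twoSided (a ⊗ₖ c) (v ⊗ₖₜ[ℂ] w) (b ⊗ₖ d) := by
  ext ⟨i, s⟩ ⟨j, t⟩
  simp only [kroneckerMap_apply, twoSided, of_apply, TensorProduct.sum_tmul]
  simp only [TensorProduct.tmul_sum, TensorProduct.smul_tmul_smul, Fintype.sum_prod_type]
  refine Finset.sum_congr rfl fun x _ => ?_
  rw [Finset.sum_comm]
  refine Finset.sum_congr rfl fun y _ => Finset.sum_congr rfl fun z _ =>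
    Finset.sum_congr rfl fun t _ => ?_
  rw [mul_mul_mul_comm]

variable [MatrixNorms V] [RuanNorms V] [MatrixNorms W] [RuanNorms W]
variable [Fintype m] [Fintype n] [Fintype k'] [Fintype l'] [Fintype p'] [Fintype q']

theorem mnorm_tensor_nonneg (u : Matrix m n (V ⊗[ℂ] W)) : 0 ≤ mnorm u := by
  refine Real.sInf_nonneg ?_
  rintro _ ⟨p, q, α, v, w, β, -, rfl⟩
  have := scalarNorm_nonneg α
  have := scalarNorm_nonneg β
  have := mnorm_nonneg v
  have := mnorm_nonneg w
  positivity

theorem exists_square_kroneckerTMul (α : Matrix m (k × p) ℂ) (v : Matrix k l V)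
    (w : Matrix p q W) (β : Matrix (l × q) n ℂ) :
    ∃ (r s : ℕ) (α' : Matrix m (Fin r × Fin s) ℂ) (v' : Matrix (Fin r) (Fin r) V)
      (w' : Matrix (Fin s) (Fin s) W) (β' : Matrix (Fin r × Fin s) n ℂ),
      twoSided α (v ⊗ₖₜ[ℂ] w) β = twoSided α' (v' ⊗ₖₜ[ℂ] w') β' ∧
      scalarNorm α' * mnorm v' * mnorm w' * scalarNorm β' ≤
        scalarNorm α * mnorm v * mnorm w * scalarNorm β := by
  have hα₀ := scalarNorm_nonneg α
  have hβ₀ := scalarNorm_nonneg β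
  have hv₀ := mnorm_nonneg v
  have hw₀ := mnorm_nonneg w
  obtain ⟨r, z, a, b, hz, ha, hb, rfl⟩ := exists_square v
  obtain ⟨s, y, c, d, hy, hc, hd, rfl⟩ := exists_square w
  have hα : scalarNorm (α * (a ⊗ₖ c)) ≤ scalarNorm α :=
    (scalarNorm_mul_le _ _).trans (mul_le_of_le_one_right hα₀
      ((scalarNorm_kronecker_le a c).trans (mul_le_one₀ ha (scalarNorm_nonneg c) hc)))
  have hβ : scalarNorm ((b ⊗ₖ d) * β) ≤ scalarNorm β :=
    (scalarNorm_mul_le _ _).trans (mul_le_of_le_one_left hβ₀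
      ((scalarNorm_kronecker_le b d).trans (mul_le_one₀ hb (scalarNorm_nonneg d) hd)))
  refine ⟨r, s, α * (a ⊗ₖ c), z, y, (b ⊗ₖ d) * β, ?_, ?_⟩
  · rw [kroneckerTMul_twoSided, twoSided_twoSided]
  · have := mnorm_nonneg z
    have := mnorm_nonneg y
    have := scalarNorm_nonneg ((b ⊗ₖ d) * β)
    gcongr

theorem mnorm_twoSided_kroneckerTMul_le (α : Matrix m (k × p) ℂ) (v : Matrix k l V)
    (w : Matrix p q W) (β : Matrix (l × q) n ℂ) :
    mnorm (twoSided α (v ⊗ₖₜ[ℂ] w) β) ≤ scalarNorm α * mnorm v * mnorm w * scalarNorm β := by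
  obtain ⟨r, s, α', v', w', β', h, hle⟩ := exists_square_kroneckerTMul α v w β
  refine le_trans (csInf_le ⟨0, ?_⟩ ⟨r, s, α', v', w', β', h, rfl⟩) hle
  rintro _ ⟨p, q, α, v, w, β, -, rfl⟩
  exact mul_nonneg (mul_nonneg (mul_nonneg (scalarNorm_nonneg α) (mnorm_nonneg v))
    (mnorm_nonneg w)) (scalarNorm_nonneg β)

omit [Fintype m] [Fintype n] in
theorem exists_twoSided_kroneckerTMul_eq_add [Finite m] [Finite n]
    (α : Matrix m (k × p) ℂ) (v : Matrix k l V) (w : Matrix p q W) (β : Matrix (l × q) n ℂ)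
    (α' : Matrix m (k' × p') ℂ) (v' : Matrix k' l' V) (w' : Matrix p' q' W)
    (β' : Matrix (l' × q') n ℂ) :
    ∃ (r s : ℕ) (a : Matrix m (Fin r × Fin s) ℂ) (x : Matrix (Fin r) (Fin r) V)
      (y : Matrix (Fin s) (Fin s) W) (b : Matrix (Fin r × Fin s) n ℂ),
      twoSided a (x ⊗ₖₜ[ℂ] y) b =
        twoSided α (v ⊗ₖₜ[ℂ] w) β + twoSided α' (v' ⊗ₖₜ[ℂ] w') β' := by
  classical
  have := Fintype.ofFinite m
  have := Fintype.ofFinite n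
  rw [← twoSided_fromCols_fromBlocks_fromRows, fromBlocks_kroneckerTMul, ← twoSided_submatrix_one,
    twoSided_twoSided]
  obtain ⟨r, s, a, x, y, b, h, -⟩ := exists_square_kroneckerTMul (fromCols α α' * _)
    (fromBlocks v 0 0 v') (fromBlocks w 0 0 w') (_ * fromRows β β')
  exact ⟨r, s, a, x, y, b, h.symm⟩

omit [Fintype m] [Fintype n] in
theorem exists_twoSided_kroneckerTMul [Finite m] [Finite n] (u : Matrix m n (V ⊗[ℂ] W)) :
    ∃ (r s : ℕ) (a : Matrix m (Fin r × Fin s) ℂ) (x : Matrix (Fin r) (Fin r) V)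
      (y : Matrix (Fin s) (Fin s) W) (b : Matrix (Fin r × Fin s) n ℂ),
      twoSided a (x ⊗ₖₜ[ℂ] y) b = u := by
  classical
  have := Fintype.ofFinite m
  have := Fintype.ofFinite n
  induction u using Matrix.induction_on' with
  | h_zero => exact ⟨0, 0, 0, 0, 0, 0, by ext; simp [twoSided]⟩
  | h_add u u' hu hu' =>
    obtain ⟨p, q, α, v, w, β, rfl⟩ := hu
    obtain ⟨p', q', α', v', w', β', rfl⟩ := hu'
    exact exists_twoSided_kroneckerTMul_eq_add α v w β α' v' w' β'
  | h_std_basis i j u =>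
    induction u using TensorProduct.induction_on with
    | zero => exact ⟨0, 0, 0, 0, 0, 0, by ext; simp [twoSided]⟩
    | tmul x y =>
      obtain ⟨r, s, a, x', y', b, h, -⟩ := exists_square_kroneckerTMul
        (single i ((), ()) (1 : ℂ)) (of fun _ _ => x) (of fun _ _ => y) (single ((), ()) j (1 : ℂ))
      refine ⟨r, s, a, x', y', b, h ▸ ?_⟩
      ext i' j'
      by_cases hi : i = i' <;> by_cases hj : j = j' <;> simp [twoSided, single_apply, hi, hj]
    | add x y hx hy =>
      obtain ⟨p, q, α, v, w, β, hx⟩ := hx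
      obtain ⟨p', q', α', v', w', β', hy⟩ := hy
      rw [single_add, ← hx, ← hy]
      exact exists_twoSided_kroneckerTMul_eq_add α v w β α' v' w' β'

theorem exists_mul_mul_lt {a b c d K : ℝ} (h : a * b * c * d < K) :
    ∃ ε : ℝ, 0 < ε ∧ (a + ε) * (b + ε) * (c + ε) * (d + ε) < K := by
  have ht : Filter.Tendsto (fun ε => (a + ε) * (b + ε) * (c + ε) * (d + ε))
      (nhdsWithin 0 (Set.Ioi 0)) (nhds (a * b * c * d)) := by
    refine Filter.Tendsto.mono_left ?_ nhdsWithin_le_nhds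
    exact Continuous.tendsto' (by fun_prop) _ _ (by simp)
  obtain ⟨ε, h, hε⟩ := ((ht.eventually_lt_const h).and eventually_mem_nhdsWithin).exists
  exact ⟨ε, hε, h⟩

theorem exists_twoSided_kroneckerTMul_of_lt {u : Matrix m n (V ⊗[ℂ] W)} {C : ℝ}
    (h : mnorm u < C) :
    ∃ (p q : ℕ) (α : Matrix m (Fin p × Fin q) ℂ) (v : Matrix (Fin p) (Fin p) V)
      (w : Matrix (Fin q) (Fin q) W) (β : Matrix (Fin p × Fin q) n ℂ),
      u = twoSided α (v ⊗ₖₜ[ℂ] w) β ∧ scalarNorm α ≤ √C ∧ mnorm v ≤ 1 ∧ mnorm w ≤ 1 ∧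
        scalarNorm β ≤ √C := by
  obtain ⟨r, s, a, x, y, b, hu⟩ := exists_twoSided_kroneckerTMul u
  obtain ⟨_, ⟨p, q, α, v, w, β, rfl, rfl⟩, hlt⟩ :=
    exists_lt_of_csInf_lt (by exact ⟨_, r, s, a, x, y, b, hu.symm, rfl⟩) h
  obtain ⟨ε, hε, hlt⟩ := exists_mul_mul_lt hlt
  have hC : 0 < √C := Real.sqrt_pos.2 ((mnorm_tensor_nonneg _).trans_lt h)
  have hCC : √C * √C = C := Real.mul_self_sqrt ((mnorm_tensor_nonneg _).trans h.le)
  obtain ⟨A, hA, hαA⟩ : ∃ A > 0, scalarNorm α + ε = A :=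
    ⟨_, add_pos_of_nonneg_of_pos (scalarNorm_nonneg α) hε, rfl⟩
  obtain ⟨B, hB, hβB⟩ : ∃ B > 0, scalarNorm β + ε = B :=
    ⟨_, add_pos_of_nonneg_of_pos (scalarNorm_nonneg β) hε, rfl⟩
  obtain ⟨D, hD, hvD⟩ : ∃ D > 0, mnorm v + ε = D :=
    ⟨_, add_pos_of_nonneg_of_pos (mnorm_nonneg v) hε, rfl⟩
  obtain ⟨E, hE, hwE⟩ : ∃ E > 0, mnorm w + ε = E :=
    ⟨_, add_pos_of_nonneg_of_pos (mnorm_nonneg w) hε, rfl⟩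
  rw [hαA, hβB, hvD, hwE] at hlt
  refine ⟨p, q, ((√C / A : ℝ) : ℂ) • α, ((D⁻¹ : ℝ) : ℂ) • v, ((E⁻¹ : ℝ) : ℂ) • w,
    ((A * D * E / √C : ℝ) : ℂ) • β, ?_, ?_, ?_, ?_, ?_⟩
  · rw [smul_kroneckerTMul, kroneckerTMul_smul, smul_smul, twoSided_smul_smul_smul]
    norm_cast
    rw [show √C / A * (D⁻¹ * E⁻¹) * (A * D * E / √C) = 1 by field_simp]
    simp
  · rw [scalarNorm_smul, Complex.norm_of_nonneg (by positivity), div_mul_eq_mul_div,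
      div_le_iff₀ hA]
    gcongr
    linarith
  · rw [mnorm_smul, Complex.norm_of_nonneg (by positivity), inv_mul_le_one₀ hD]
    linarith
  · rw [mnorm_smul, Complex.norm_of_nonneg (by positivity), inv_mul_le_one₀ hE]
    linarith
  · rw [scalarNorm_smul, Complex.norm_of_nonneg (by positivity), div_mul_eq_mul_div,
      div_le_iff₀ hC, hCC]
    refine le_trans ?_ hlt.le
    gcongr
    linarith

theorem mnorm_twoSided_tensor_le (α : Matrix m k ℂ) (u : Matrix k l (V ⊗[ℂ] W))
    (β : Matrix l n ℂ) : mnorm (twoSided α u β) ≤ scalarNorm α * mnorm u * scalarNorm β := by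
  have hα := scalarNorm_nonneg α
  have hβ := scalarNorm_nonneg β
  have hlim : Filter.Tendsto (fun C => scalarNorm α * C * scalarNorm β)
      (nhdsWithin (mnorm u) (Set.Ioi (mnorm u)))
      (nhds (scalarNorm α * mnorm u * scalarNorm β)) :=
    ((Filter.tendsto_id.const_mul _).mul_const _).mono_left nhdsWithin_le_nhds
  refine ge_of_tendsto hlim ?_
  filter_upwards [self_mem_nhdsWithin] with C hC
  obtain ⟨p, q, a, v, w, b, rfl, ha, hv, hw, hb⟩ := exists_twoSided_kroneckerTMul_of_lt hC
  have hC₀ := (mnorm_tensor_nonneg _).trans_lt hC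
  rw [twoSided_twoSided]
  calc _ ≤ _ := mnorm_twoSided_kroneckerTMul_le _ _ _ _
    _ ≤ (scalarNorm α * √C) * 1 * 1 * (√C * scalarNorm β) := by
      have := mnorm_nonneg v
      have := mnorm_nonneg w
      have := scalarNorm_nonneg (b * β)
      gcongr
      · exact (scalarNorm_mul_le _ _).trans (by gcongr)
      · exact (scalarNorm_mul_le _ _).trans (by gcongr)
    _ = scalarNorm α * (√C * √C) * scalarNorm β := by ring
    _ = _ := by rw [Real.mul_self_sqrt hC₀.le]

theorem mnorm_fromBlocks_kroneckerTMul_le (v : Matrix k l V) (w : Matrix p q W)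
    (v' : Matrix k' l' V) (w' : Matrix p' q' W) :
    mnorm (fromBlocks (v ⊗ₖₜ[ℂ] w) 0 0 (v' ⊗ₖₜ[ℂ] w')) ≤
      max (mnorm v) (mnorm v') * max (mnorm w) (mnorm w') := by
  classical
  rw [fromBlocks_kroneckerTMul, ← twoSided_submatrix_one]
  refine (mnorm_twoSided_kroneckerTMul_le _ _ _ _).trans ?_
  rw [mul_assoc (scalarNorm _)]
  have hv := mnorm_nonneg (fromBlocks v 0 0 v')
  have hw := mnorm_nonneg (fromBlocks w 0 0 w')
  refine (mul_mul_le_of_le_one (scalarNorm_submatrix_one_le injective_sumElim_map_inl_inr)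
    (mul_nonneg hv hw) (scalarNorm_nonneg _)
    (scalarNorm_submatrix_one_right_le injective_sumElim_map_inl_inr)).trans ?_
  exact mul_le_mul (mnorm_fromBlocks_le v v') (mnorm_fromBlocks_le w w') hw
    (hv.trans (mnorm_fromBlocks_le v v'))

instance : RuanNorms (V ⊗[ℂ] W) where
  mnorm_nonneg := mnorm_tensor_nonneg
  mnorm_twoSided_le := mnorm_twoSided_tensor_le
  mnorm_fromBlocks_le x y := by
    refine le_of_forall_gt_imp_ge_of_dense fun C hC => ?_
    obtain ⟨p, q, a, v, w, b, rfl, ha, hv, hw, hb⟩ :=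
      exists_twoSided_kroneckerTMul_of_lt ((le_max_left _ _).trans_lt hC)
    obtain ⟨p', q', a', v', w', b', rfl, ha', hv', hw', hb'⟩ :=
      exists_twoSided_kroneckerTMul_of_lt ((le_max_right _ _).trans_lt hC)
    have hC₀ := (mnorm_tensor_nonneg _).trans_lt ((le_max_left _ _).trans_lt hC)
    rw [← twoSided_fromBlocks]
    refine (mnorm_twoSided_tensor_le _ _ _).trans ?_
    calc _ ≤ √C * (1 * 1) * √C := by
          have := mnorm_tensor_nonneg (fromBlocks (v ⊗ₖₜ[ℂ] w) 0 0 (v' ⊗ₖₜ[ℂ] w'))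
          have := scalarNorm_nonneg (fromBlocks b 0 0 b')
          gcongr
          · exact (scalarNorm_fromBlocks_le a a').trans (max_le ha ha')
          · refine (mnorm_fromBlocks_kroneckerTMul_le v w v' w').trans ?_
            have := (mnorm_nonneg w).trans (le_max_left _ (mnorm w'))
            gcongr
            exacts [max_le hv hv', max_le hw hw']
          · exact (scalarNorm_fromBlocks_le b b').trans (max_le hb hb')
      _ = C := by rw [mul_one, mul_one, Real.mul_self_sqrt hC₀.le]

end Tensor

/-! ### Columns and rows of linear maps -/

section Families

open scoped TensorProduct Kronecker Matrix.Norms.Frobenius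

variable {ι m n k l : Type} {V W : Type*}
variable [AddCommGroup V] [Module ℂ V] [AddCommGroup W] [Module ℂ W]

/-- The amplification of the column `x ↦ (T s x)_s` of linear maps to matrices. -/
def columnMap (T : ι → V →ₗ[ℂ] W) (x : Matrix m n V) : Matrix (ι × m) n W :=
  of fun p j => T p.1 (x p.2 j)

/-- The amplification of the map `(x_s)_s ↦ ∑ T s x_s` on columns to matrices. -/
def columnSum [Fintype ι] (T : ι → V →ₗ[ℂ] W) (x : Matrix (ι × m) n V) : Matrix m n W :=
  of fun i j => ∑ s, T s (x (s, i) j)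

/-- A column of matrices `α_s`, rearranged as the row `[α_1 ⋯ α_r]`. -/
def blockRow : Matrix (ι × m) k ℂ ≃ Matrix m (ι × k) ℂ where
  toFun α := of fun i p => α (p.1, i) p.2
  invFun α := of fun p j => α p.2 (p.1, j)

theorem blockRow_apply (α : Matrix (ι × m) k ℂ) (i : m) (p : ι × k) :
    blockRow α i p = α (p.1, i) p.2 := rfl

theorem norm_blockRow [Fintype ι] [Fintype m] [Fintype k] (α : Matrix (ι × m) k ℂ) :
    ‖blockRow α‖ = ‖α‖ := by
  rw [← sq_eq_sq₀ (norm_nonneg _) (norm_nonneg _), frobenius_norm_sq, frobenius_norm_sq]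
  simp only [Fintype.sum_prod_type, blockRow_apply]
  exact Finset.sum_comm

variable [Fintype k] [Fintype l]

theorem columnMap_twoSided [Fintype ι] [DecidableEq ι] (T : ι → V →ₗ[ℂ] W) (α : Matrix m k ℂ)
    (x : Matrix k l V) (β : Matrix l n ℂ) :
    columnMap T (twoSided α x β) =
      twoSided ((1 : Matrix ι ι ℂ) ⊗ₖ α) (columnMap T x) β := by
  ext ⟨s, i⟩ j
  simp [columnMap, twoSided, one_apply, Fintype.sum_prod_type]

variable [Fintype ι]

theorem columnSum_twoSided (T : ι → V →ₗ[ℂ] W) (α : Matrix (ι × m) k ℂ) (x : Matrix k l V)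
    (β : Matrix l n ℂ) :
    columnSum T (twoSided α x β) = twoSided (blockRow α) (columnMap T x) β := by
  ext i j
  simp [columnSum, columnMap, blockRow_apply, twoSided, Fintype.sum_prod_type]

variable [Fintype m] [Fintype n]

theorem pair_columnSum (T : ι → V →ₗ[ℂ] W) (f : Matrix m n (Module.Dual ℂ W))
    (x : Matrix (ι × m) n V) :
    pair f (columnSum T x) = pair (columnMap (fun s => (T s).dualMap) f) x := by
  simp only [pair_apply, Fintype.sum_prod_type, columnSum, columnMap, of_apply, map_sum,
    LinearMap.dualMap_apply]
  exact (Finset.sum_comm.trans (Finset.sum_congr rfl fun _ _ => Finset.sum_comm)).symm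

theorem pair_columnMap (T : ι → V →ₗ[ℂ] W) (f : Matrix (ι × m) n (Module.Dual ℂ W))
    (x : Matrix m n V) :
    pair f (columnMap T x) = pair (columnSum (fun s => (T s).dualMap) f) x := by
  simp only [pair_apply, Fintype.sum_prod_type, columnSum, columnMap, of_apply,
    LinearMap.sum_apply, LinearMap.dualMap_apply]
  exact Finset.sum_comm.trans (Finset.sum_congr rfl fun _ _ => Finset.sum_comm)

end Families

section RowProj

open scoped TensorProduct Kronecker Matrix.Norms.Frobenius

variable {m n k l : Type} {V W : Type*} {r : ℕ}
variable [AddCommGroup V] [Module ℂ V] [AddCommGroup W] [Module ℂ W]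

/-- The embedding `x ↦ e_s ⊗ x` of `V` into `R_r[V]`. -/
def rowInclusion (s : Fin r) : V →ₗ[ℂ] RowProj r V :=
  TensorProduct.mk ℂ (Row r ℂ) V (single 0 s 1)

/-- The `s`-th coordinate `R_r[V] → V`. -/
def rowCoord (s : Fin r) : RowProj r V →ₗ[ℂ] V :=
  TensorProduct.lid ℂ V ∘ₗ LinearMap.rTensor V (entryLinearMap ℂ ℂ 0 s)

@[simp]
theorem rowCoord_rowInclusion (s t : Fin r) (x : V) :
    rowCoord s (rowInclusion t x) = if s = t then x else 0 := by
  simp [rowCoord, rowInclusion, single_apply, eq_comm]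

/-- The map `x ↦ [T_1 x ⋯ T_r x]` into `R_r[W]`. -/
def rowMap (T : Fin r → V →ₗ[ℂ] W) : V →ₗ[ℂ] RowProj r W :=
  ∑ s, rowInclusion s ∘ₗ T s

/-- The map `[x_1 ⋯ x_r] ↦ ∑ T_s x_s` on `R_r[V]`. -/
def rowSum (T : Fin r → V →ₗ[ℂ] W) : RowProj r V →ₗ[ℂ] W :=
  ∑ s, T s ∘ₗ rowCoord s

@[simp]
theorem rowCoord_rowMap (T : Fin r → V →ₗ[ℂ] W) (s : Fin r) (x : V) :
    rowCoord s (rowMap T x) = T s x := by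
  simp [rowMap]

@[simp]
theorem rowSum_rowInclusion (T : Fin r → V →ₗ[ℂ] W) (s : Fin r) (x : V) :
    rowSum T (rowInclusion s x) = T s x := by
  simp [rowSum, apply_ite]

theorem columnSum_rowInclusion_columnMap (T : Fin r → V →ₗ[ℂ] W) (x : Matrix m n V) :
    columnSum rowInclusion (columnMap T x) = x.map (rowMap T) := by
  ext i j
  simp [columnSum, columnMap, rowMap]

/-- The coordinates of a matrix of functionals on `R_r[V]`, which identify `R_r[V]*` with
`C_r(V*)`. -/
def coords (h : Matrix m n (Module.Dual ℂ (RowProj r V))) :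
    Matrix (Fin r × m) n (Module.Dual ℂ V) :=
  columnMap (fun s => (rowInclusion s).dualMap) h

theorem exists_coords_eq (H : Matrix (Fin r × m) n (Module.Dual ℂ V)) :
    ∃ h : Matrix m n (Module.Dual ℂ (RowProj r V)), coords h = H :=
  ⟨of fun i j => rowSum fun s => H (s, i) j, by
    ext ⟨s, i⟩ j x
    simp [coords, columnMap]⟩

theorem pair_coords_columnMap [Fintype m] [Fintype n]
    (h : Matrix m n (Module.Dual ℂ (RowProj r W))) (T : Fin r → V →ₗ[ℂ] W) (x : Matrix m n V) :
    pair (coords h) (columnMap T x) = pair h (x.map (rowMap T)) := by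
  rw [coords, ← pair_columnSum, columnSum_rowInclusion_columnMap]

theorem kroneckerTMul_eq_twoSided_columnMap {p q : Type} [Fintype q] [DecidableEq q] [Fintype k]
    [DecidableEq k] [Fintype l] [DecidableEq l] (v : Matrix p q (Row r ℂ)) (w : Matrix k l V) :
    v ⊗ₖₜ[ℂ] w = twoSided
      ((comp p q (Fin 1) (Fin r) ℂ v ⊗ₖ (1 : Matrix k k ℂ)).submatrix
        (fun i : p × k => ((i.1, 0), i.2)) (fun t : Fin r × k × q => ((t.2.2, t.1), t.2.1)))
      (columnMap rowInclusion ((blockDiagonal fun _ : q => w).submatrix id Prod.swap)) 1 := by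
  ext ⟨i, i'⟩ ⟨j, j'⟩
  have hv : v i j = ∑ s, single 0 s (v i j 0 s) := by
    ext a s
    simp [Subsingleton.elim a 0, Matrix.sum_apply, single_apply]
  rw [kroneckerMap_apply, hv, TensorProduct.sum_tmul]
  simp [twoSided, Fintype.sum_prod_type, columnMap, blockDiagonal_apply, one_apply, rowInclusion,
    TensorProduct.smul_tmul', apply_ite, ite_and]

theorem exists_twoSided_columnMap_rowInclusion_of_lt [MatrixNorms V] [RuanNorms V] [Fintype m]
    [Fintype n] {u : Matrix m n (RowProj r V)} {C : ℝ} (h : mnorm u < C) :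
    ∃ (κ κ' : Type) (_ : Fintype κ) (_ : Fintype κ') (a : Matrix m (Fin r × κ) ℂ)
      (w : Matrix κ κ' V) (b : Matrix κ' n ℂ), u = twoSided a (columnMap rowInclusion w) b ∧
      scalarNorm a ≤ √C ∧ mnorm w ≤ 1 ∧ scalarNorm b ≤ √C := by
  classical
  obtain ⟨p, q, α, v, w, β, rfl, hα, hv, hw, hβ⟩ := exists_twoSided_kroneckerTMul_of_lt h
  rw [kroneckerTMul_eq_twoSided_columnMap, twoSided_twoSided, Matrix.one_mul]
  refine ⟨_, _, inferInstance, inferInstance, _, _, β, rfl, ?_, ?_, hβ⟩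
  · refine (scalarNorm_mul_le _ _).trans
      ((mul_le_of_le_one_right (scalarNorm_nonneg α) ?_).trans hα)
    refine (mnorm_submatrix_le (V := ℂ) _ (fun _ _ h => ?_) (fun _ _ h => ?_)).trans
      ((scalarNorm_kronecker_one_le _).trans hv)
    · simpa [Prod.ext_iff] using h
    · simp only [Prod.mk.injEq] at h
      exact Prod.ext h.1.2 (Prod.ext h.2 h.1.1)
  · exact (mnorm_submatrix_le _ Function.injective_id Prod.swap_injective).trans
      (mnorm_blockDiagonal_le zero_le_one fun _ => hw)

end RowProj

section Contractions

open scoped TensorProduct Kronecker Matrix.Norms.Frobenius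

variable {V W : Type*} [AddCommGroup V] [Module ℂ V] [AddCommGroup W] [Module ℂ W]
variable [MatrixNorms V] [MatrixNorms W]

/-- The map `x ↦ (T s x)_s` from `V` to columns over `W` is completely contractive. -/
def IsColumnContraction {ι : Type} [Fintype ι] (T : ι → V →ₗ[ℂ] W) : Prop :=
  ∀ ⦃m n : Type⦄ [Fintype m] [Fintype n] (x : Matrix m n V), mnorm (columnMap T x) ≤ mnorm x

/-- The map `(x_s)_s ↦ ∑ T s x_s` from columns over `V` to `W` is completely contractive. -/
def IsColumnSumContraction {ι : Type} [Fintype ι] (T : ι → V →ₗ[ℂ] W) : Prop :=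
  ∀ ⦃m n : Type⦄ [Fintype m] [Fintype n] (x : Matrix (ι × m) n V),
    mnorm (columnSum T x) ≤ mnorm x

/-- The map `rowMap T : V → R_r[W]` is completely contractive. -/
def IsRowContraction {r : ℕ} (T : Fin r → V →ₗ[ℂ] W) : Prop :=
  ∀ ⦃m n : Type⦄ [Fintype m] [Fintype n] (x : Matrix m n V), mnorm (x.map (rowMap T)) ≤ mnorm x

variable {ι m n : Type} [Fintype ι] [Fintype m] [Fintype n] {r : ℕ}

theorem IsColumnContraction.cbBound_columnMap_dualMap {T : ι → V →ₗ[ℂ] W}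
    (hT : IsColumnContraction T) {f : Matrix m n (Module.Dual ℂ W)} {C : ℝ} (hC : 0 ≤ C)
    (hf : CBBound f C) : CBBound (columnMap (fun s => (T s).dualMap) f) C := by
  intro k l _ _ α x β
  rw [← pair_columnSum, columnSum_twoSided, ← norm_blockRow α]
  refine (hf _ _ _).trans ?_
  gcongr
  exact hT x

variable [RuanNorms V] [RuanNorms W]

theorem mnorm_twoSided_le_of_le_sqrt {k l : Type} [Fintype k] [Fintype l] {α : Matrix m k ℂ}
    {x : Matrix k l V} {β : Matrix l n ℂ} {C : ℝ} (hC : 0 ≤ C) (hα : scalarNorm α ≤ √C)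
    (hx : mnorm x ≤ 1) (hβ : scalarNorm β ≤ √C) : mnorm (twoSided α x β) ≤ C :=
  (mnorm_twoSided_le_of_le hα hx hβ).trans_eq (by rw [mul_one, Real.mul_self_sqrt hC])

theorem isColumnContraction_rowInclusion :
    IsColumnContraction (rowInclusion : Fin r → V →ₗ[ℂ] RowProj r V) := by
  classical
  intro m n _ _ x
  let E : Matrix (Fin r) Unit (Row r ℂ) := of fun s _ => single 0 s 1
  have hE : mnorm E ≤ 1 := by
    have h : comp _ _ _ _ _ E = (1 : Matrix (Fin r) (Fin r) ℂ).submatrix Prod.fst Prod.snd := by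
      ext ⟨s, a⟩ ⟨-, t⟩
      simp [E, Subsingleton.elim a 0, single_apply, one_apply]
    change mnorm (comp _ _ _ _ ℂ E) ≤ 1
    rw [h]
    exact (mnorm_submatrix_equiv 1 (Equiv.prodUnique _ _) (Equiv.uniqueProd _ _)).trans_le
      scalarNorm_one_le
  have hx : columnMap rowInclusion x =
      (twoSided 1 (E ⊗ₖₜ[ℂ] x) 1).submatrix id fun j => ((), j) := by
    rw [twoSided_one]
    rfl
  rw [hx]
  refine (mnorm_submatrix_le _ Function.injective_id (Prod.mk_right_injective ())).trans ?_
  refine (mnorm_twoSided_kroneckerTMul_le _ _ _ _).trans ?_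
  have hx₀ := mnorm_nonneg x
  calc _ ≤ 1 * 1 * mnorm x * 1 := by
        gcongr
        exacts [scalarNorm_nonneg _, mnorm_nonneg E, scalarNorm_one_le, scalarNorm_one_le]
    _ = mnorm x := by simp

theorem cbBound_coords_iff {h : Matrix m n (Module.Dual ℂ (RowProj r V))} {C : ℝ} (hC : 0 ≤ C) :
    CBBound (coords h) C ↔ CBBound h C := by
  refine ⟨fun hh k l _ _ α u β => ?_,
    isColumnContraction_rowInclusion.cbBound_columnMap_dualMap hC⟩
  have huD (D : ℝ) (hD : mnorm u < D) : ‖pair h (twoSided α u β)‖ ≤ C * ‖α‖ * ‖β‖ * D := by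
    obtain ⟨κ, κ', _, _, a, w, b, rfl, ha, hw, hb⟩ :=
      exists_twoSided_columnMap_rowInclusion_of_lt hD
    obtain ⟨α', hα'⟩ := blockRow.surjective (α * a)
    have hα'_le : ‖α'‖ ≤ ‖α‖ * √D := by
      rw [← norm_blockRow, hα']
      exact (norm_mul_le_mul_scalarNorm α a).trans (by gcongr)
    have hβ_le : ‖b * β‖ ≤ √D * ‖β‖ := (norm_mul_le_scalarNorm_mul b β).trans (by gcongr)
    have hw₀ := mnorm_nonneg w
    rw [twoSided_twoSided, ← hα', ← columnSum_twoSided, pair_columnSum]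
    calc ‖pair (coords h) (twoSided α' w (b * β))‖
        ≤ C * (‖α'‖ * mnorm w * ‖b * β‖) := hh _ _ _
      _ ≤ C * (‖α‖ * √D * 1 * (√D * ‖β‖)) := by gcongr
      _ = C * ‖α‖ * ‖β‖ * (√D * √D) := by ring
      _ = C * ‖α‖ * ‖β‖ * D := by rw [Real.mul_self_sqrt ((mnorm_nonneg _).trans hD.le)]
  calc ‖pair h (twoSided α u β)‖ ≤ C * ‖α‖ * ‖β‖ * mnorm u :=
        le_mul_of_forall_lt₀ fun K hK D hD => (huD D hD).trans
          (mul_le_mul_of_nonneg_right hK.le ((mnorm_nonneg u).trans hD.le))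
    _ = C * (‖α‖ * mnorm u * ‖β‖) := by ring

theorem IsColumnContraction.mnorm_map_rowSum_le {T : Fin r → V →ₗ[ℂ] W}
    (hT : IsColumnContraction T) (u : Matrix m n (RowProj r V)) :
    mnorm (u.map (rowSum T)) ≤ mnorm u := by
  refine le_of_forall_gt_imp_ge_of_dense fun C hC => ?_
  obtain ⟨κ, κ', _, _, a, w, b, rfl, ha, hw, hb⟩ := exists_twoSided_columnMap_rowInclusion_of_lt hC
  have h : (columnMap rowInclusion w).map (rowSum T) = columnMap T w := by
    ext
    simp [columnMap]
  rw [map_twoSided, h]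
  exact mnorm_twoSided_le_of_le_sqrt ((mnorm_nonneg _).trans hC.le) ha ((hT w).trans hw) hb

theorem isColumnContraction_rowInclusion_comp_rowCoord :
    IsColumnContraction fun s : Fin r => (rowInclusion s : V →ₗ[ℂ] _) ∘ₗ rowCoord s := by
  classical
  intro m n _ _ u
  refine le_of_forall_gt_imp_ge_of_dense fun C hC => ?_
  obtain ⟨κ, κ', _, _, a, w, b, rfl, ha, hw, hb⟩ := exists_twoSided_columnMap_rowInclusion_of_lt hC
  let J := (1 : Matrix (Fin r × Fin r × κ) (Fin r × Fin r × κ) ℂ).submatrix id fun p => (p.1, p)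
  have hJ : columnMap (fun s => rowInclusion s ∘ₗ rowCoord s) (columnMap rowInclusion w) =
      twoSided J (columnMap rowInclusion w) 1 := by
    ext ⟨s, t, i⟩ j
    rcases eq_or_ne t s with rfl | hts <;>
      simp [columnMap, twoSided, J, one_apply, Fintype.sum_prod_type, ite_and, *, Ne.symm]
  have haJ : scalarNorm ((1 : Matrix (Fin r) (Fin r) ℂ) ⊗ₖ a * J) ≤ √C := by
    refine (scalarNorm_mul_le _ _).trans ?_
    refine (mul_le_of_le_one_right (scalarNorm_nonneg _) (scalarNorm_submatrix_one_right_le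
      fun _ _ h => (Prod.mk.inj h).2)).trans ?_
    refine (scalarNorm_kronecker_le _ _).trans ?_
    exact (mul_le_of_le_one_left (scalarNorm_nonneg a) scalarNorm_one_le).trans ha
  rw [columnMap_twoSided, hJ, twoSided_twoSided, Matrix.one_mul]
  exact mnorm_twoSided_le_of_le_sqrt ((mnorm_nonneg _).trans hC.le) haJ
    ((isColumnContraction_rowInclusion w).trans hw) hb

end Contractions

/-! ### Complete orthogonal idempotents -/

section Square

open scoped TensorProduct Kronecker

variable {V W : Type*} [AddCommGroup V] [Module ℂ V] [AddCommGroup W] [Module ℂ W]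
variable [MatrixNorms V] [MatrixNorms W] [RuanNorms V] [RuanNorms W]
variable {ι m n : Type} [Fintype ι] [Fintype m] [Fintype n]

theorem IsCompleteIsometry.mnorm_map {φ : V →ₗ[ℂ] W} (hφ : IsCompleteIsometry φ)
    (x : Matrix m n V) : mnorm (x.map φ) = mnorm x := by
  obtain ⟨r, α, α', β', β, hα, hα', hβ', hβ, hx⟩ := exists_square_dilation x
  refine le_antisymm ?_ ?_
  · calc mnorm (x.map φ) ≤ mnorm ((twoSided α' x β').map φ) := by
          conv_lhs => rw [← hx, map_twoSided]
          exact mnorm_twoSided_le_of_le_one _ hα hβ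
      _ = mnorm (twoSided α' x β') := hφ r _
      _ ≤ mnorm x := mnorm_twoSided_le_of_le_one x hα' hβ'
  · calc mnorm x ≤ mnorm (twoSided α' x β') := by
          conv_lhs => rw [← hx]
          exact mnorm_twoSided_le_of_le_one _ hα hβ
      _ = mnorm ((twoSided α' x β').map φ) := (hφ r _).symm
      _ ≤ mnorm (x.map φ) := by
        rw [map_twoSided]
        exact mnorm_twoSided_le_of_le_one _ hα' hβ'

theorem mnorm_columnMap_eq_of_square {T : ι → V →ₗ[ℂ] W}
    (h : ∀ (r : ℕ) (x : Matrix (Fin r) (Fin r) V), mnorm (columnMap T x) = mnorm x)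
    (x : Matrix m n V) : mnorm (columnMap T x) = mnorm x := by
  classical
  obtain ⟨r, α, α', β', β, hα, hα', hβ', hβ, hx⟩ := exists_square_dilation x
  have h1 {p q : Type} [Fintype p] [Fintype q] {a : Matrix p q ℂ} (ha : scalarNorm a ≤ 1) :
      scalarNorm ((1 : Matrix ι ι ℂ) ⊗ₖ a) ≤ 1 :=
    (scalarNorm_kronecker_le _ _).trans
      (mul_le_one₀ scalarNorm_one_le (scalarNorm_nonneg a) ha)
  refine le_antisymm ?_ ?_
  · calc mnorm (columnMap T x) ≤ mnorm (columnMap T (twoSided α' x β')) := by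
          conv_lhs => rw [← hx, columnMap_twoSided]
          exact mnorm_twoSided_le_of_le_one _ (h1 hα) hβ
      _ = mnorm (twoSided α' x β') := h r _
      _ ≤ mnorm x := mnorm_twoSided_le_of_le_one x hα' hβ'
  · calc mnorm x ≤ mnorm (twoSided α' x β') := by
          conv_lhs => rw [← hx]
          exact mnorm_twoSided_le_of_le_one _ hα hβ
      _ = mnorm (columnMap T (twoSided α' x β')) := (h r _).symm
      _ ≤ mnorm (columnMap T x) := by
        rw [columnMap_twoSided]
        exact mnorm_twoSided_le_of_le_one _ (h1 hα') hβ'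

end Square

section CompleteOrthogonalIdempotents

open scoped TensorProduct Kronecker

variable {V : Type*} [AddCommGroup V] [Module ℂ V] {m n : Type}

theorem orthogonalIdempotents_apply_apply {ι : Type} [DecidableEq ι] {T : ι → Module.End ℂ V}
    (hT : OrthogonalIdempotents T) (s t : ι) (x : V) :
    T s (T t x) = if s = t then T s x else 0 := by
  rw [← Module.End.mul_apply, hT.mul_eq]
  split_ifs <;> rfl

theorem columnSum_columnMap {ι : Type} [Fintype ι] {T : ι → Module.End ℂ V}
    (hT : CompleteOrthogonalIdempotents T) (x : Matrix m n V) :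
    columnSum T (columnMap T x) = x := by
  ext i j
  calc ∑ s, T s (T s (x i j)) = (∑ s, T s) (x i j) := by
        simp only [LinearMap.sum_apply, ← Module.End.mul_apply, (hT.idem _).eq]
    _ = x i j := by rw [hT.complete, Module.End.one_apply]

theorem map_rowSum_map_rowMap {r : ℕ} {T : Fin r → Module.End ℂ V}
    (hT : CompleteOrthogonalIdempotents T) (x : Matrix m n V) :
    (x.map (rowMap T)).map (rowSum T) = x := by
  calc (x.map (rowMap T)).map (rowSum T) = columnSum T (columnMap T x) := by
        ext i j
        simp [rowSum, columnSum, columnMap]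
    _ = x := columnSum_columnMap hT x

variable [MatrixNorms V] [RuanNorms V] [Fintype m] [Fintype n]

theorem forall_mnorm_columnMap_eq_iff {ι : Type} [Fintype ι] {T : ι → Module.End ℂ V}
    (hT : CompleteOrthogonalIdempotents T) :
    (∀ (n : ℕ) (x : Matrix (Fin n) (Fin n) V), mnorm (columnMap T x) = mnorm x) ↔
      IsColumnContraction T ∧ IsColumnSumContraction T := by
  classical
  refine ⟨fun h => ?_, fun ⟨h₁, h₂⟩ n x => (h₁ x).antisymm ?_⟩
  · refine ⟨fun m n _ _ x => (mnorm_columnMap_eq_of_square h x).le, fun m n _ _ y => ?_⟩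
    have hy : columnMap T (columnSum T y) =
        (columnMap T y).submatrix (fun p => (p.1, p.1, p.2)) id := by
      ext ⟨s, i⟩ j
      simp [columnMap, columnSum, orthogonalIdempotents_apply_apply hT.toOrthogonalIdempotents]
    calc mnorm (columnSum T y) = mnorm (columnMap T (columnSum T y)) :=
          (mnorm_columnMap_eq_of_square h _).symm
      _ ≤ mnorm (columnMap T y) := hy ▸ mnorm_submatrix_le _
        (fun p q h => (Prod.mk.inj h).2) Function.injective_id
      _ = mnorm y := mnorm_columnMap_eq_of_square h y
  · calc mnorm x = mnorm (columnSum T (columnMap T x)) := by rw [columnSum_columnMap hT]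
      _ ≤ mnorm (columnMap T x) := h₂ _

theorem isCompleteIsometry_rowMap_iff {r : ℕ} {T : Fin r → Module.End ℂ V}
    (hT : CompleteOrthogonalIdempotents T) :
    IsCompleteIsometry (rowMap T) ↔ IsColumnContraction T ∧ IsRowContraction T := by
  refine ⟨fun h => ?_, fun ⟨h₁, h₂⟩ n x => (h₂ x).antisymm ?_⟩
  · refine ⟨fun m n _ _ x => ?_, fun m n _ _ x => (h.mnorm_map x).le⟩
    have hx : (columnMap T x).map (rowMap T) =
        columnMap (fun s => rowInclusion s ∘ₗ rowCoord s) (x.map (rowMap T)) := by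
      ext ⟨s, i⟩ j
      simp [columnMap, rowMap, orthogonalIdempotents_apply_apply hT.toOrthogonalIdempotents,
        apply_ite]
    calc mnorm (columnMap T x) = mnorm ((columnMap T x).map (rowMap T)) := (h.mnorm_map _).symm
      _ ≤ mnorm (x.map (rowMap T)) :=
        hx ▸ isColumnContraction_rowInclusion_comp_rowCoord _
      _ = mnorm x := h.mnorm_map x
  · calc mnorm x = mnorm ((x.map (rowMap T)).map (rowSum T)) := by rw [map_rowSum_map_rowMap hT]
      _ ≤ mnorm (x.map (rowMap T)) := h₁.mnorm_map_rowSum_le _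

end CompleteOrthogonalIdempotents

/-! ### Complete projections -/

section Projections

variable {V : Type*} [AddCommGroup V] [Module ℂ V]

/-- The pair `P, I - P` attached to a projection `P`. -/
def splitting (P : Module.End ℂ V) : Fin 2 → Module.End ℂ V := ![P, 1 - P]

theorem completeOrthogonalIdempotents_splitting {P : Module.End ℂ V} (hP : P ∘ₗ P = P) :
    CompleteOrthogonalIdempotents (splitting P) :=
  CompleteOrthogonalIdempotents.of_isIdempotentElem hP

theorem rowMap_splitting (P : Module.End ℂ V) : rowMap (splitting P) = nuRow P := by
  have h₀ : (single 0 0 1 : Row 2 ℂ) = !![1, 0] := by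
    ext i j
    fin_cases i; fin_cases j <;> rfl
  have h₁ : (single 0 1 1 : Row 2 ℂ) = !![0, 1] := by
    ext i j
    fin_cases i; fin_cases j <;> rfl
  rw [rowMap, Fin.sum_univ_two, rowInclusion, rowInclusion, h₀, h₁]
  rfl

theorem forall_mapMatrix_comp_mapMatrix_iff {P : Module.End ℂ V} :
    (∀ n, (P.mapMatrix ∘ₗ P.mapMatrix : Matrix (Fin n) (Fin n) V →ₗ[ℂ] _) = P.mapMatrix) ↔
      P ∘ₗ P = P := by
  refine ⟨fun h => LinearMap.ext fun x => ?_, fun h n => ?_⟩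
  · exact congrFun₂ (LinearMap.congr_fun (h 1) (of fun _ _ => x)) 0 0
  · ext x i j
    exact LinearMap.congr_fun h (x i j)

variable [MatrixNorms V] [RuanNorms V]

theorem isCompleteRightLProjection_iff {P : Module.End ℂ V} :
    IsCompleteRightLProjection P ↔ P ∘ₗ P = P ∧
      IsColumnContraction (splitting P) ∧ IsRowContraction (splitting P) :=
  and_congr_right fun hP => by
    rw [← rowMap_splitting,
      isCompleteIsometry_rowMap_iff (completeOrthogonalIdempotents_splitting hP)]

theorem elemNorm_matrix {n : ℕ} (x : Matrix (Fin n) (Fin n) V) : elemNorm x = mnorm x :=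
  mnorm_submatrix_equiv x (Equiv.uniqueProd _ _) (Equiv.uniqueProd _ _)

theorem elemNorm_column {n : ℕ} (P : Module.End ℂ V) (x : Matrix (Fin n) (Fin n) V) :
    elemNorm (!![P.mapMatrix x; x - P.mapMatrix x] : Col 2 (Matrix (Fin n) (Fin n) V)) =
      mnorm (columnMap (splitting P) x) := by
  have h : comp _ _ _ _ _ (comp _ _ _ _ _ (of fun _ _ : Fin 1 =>
      (!![P.mapMatrix x; x - P.mapMatrix x] : Col 2 (Matrix (Fin n) (Fin n) V)))) =
      (columnMap (splitting P) x).submatrix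
        ((Equiv.uniqueProd _ _).prodCongr (Equiv.refl _))
        (((Equiv.uniqueProd _ _).prodCongr (Equiv.refl _)).trans (Equiv.uniqueProd _ _)) := by
    ext ⟨⟨a, s⟩, i⟩ ⟨⟨b, c⟩, j⟩
    fin_cases s <;> simp [columnMap, splitting, comp_apply]
  change mnorm (comp _ _ _ _ V (comp _ _ _ _ _ _)) = _
  rw [h, mnorm_submatrix_equiv]

theorem isCompleteLeftMProjection_iff {P : Module.End ℂ V} :
    IsCompleteLeftMProjection P ↔ P ∘ₗ P = P ∧
      IsColumnContraction (splitting P) ∧ IsColumnSumContraction (splitting P) := by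
  simp only [IsCompleteLeftMProjection, IsLeftMProjection, forall_and,
    forall_mapMatrix_comp_mapMatrix_iff, elemNorm_matrix, elemNorm_column]
  refine and_congr_right fun hP => ?_
  rw [← forall_mnorm_columnMap_eq_iff (completeOrthogonalIdempotents_splitting hP)]
  simp only [eq_comm]

end Projections

/-! ### Duality -/

section Bidual

open scoped Matrix.Norms.Frobenius

variable {X : Type*} [NormedAddCommGroup X] [NormedSpace ℂ X]
variable {m n k l : Type} [Fintype m] [Fintype n] [Fintype k] [Fintype l]

/-- The canonical map `M_{m,n}(X) → M_{m,n}(X**)`, at the level of algebraic functionals. -/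
def evaluation (x : Matrix m n X) : Matrix m n (Module.Dual ℂ (StrongDual ℂ X)) :=
  x.map (ContinuousLinearMap.coeLM ℂ).flip

theorem pair_evaluation (x : Matrix m n X) (f : Matrix m n (StrongDual ℂ X)) :
    pair (evaluation x) f = pair (toDual f) x := by
  rw [pair_apply, pair_apply]
  rfl

theorem pair_toDual_twoSided (α : Matrix m k ℂ) (f : Matrix k l (StrongDual ℂ X))
    (β : Matrix l n ℂ) (x : Matrix m n X) :
    pair (toDual (twoSided α f β)) x = pair (toDual f) (twoSided αᵀ x βᵀ) := by
  rw [toDual_twoSided, pair_twoSided, transpose_transpose, transpose_transpose]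

variable [OperatorSpace X]

theorem cbBound_evaluation (x : Matrix m n X) : CBBound (evaluation x) (mnorm x) := by
  intro k l _ _ α f β
  rw [pair_evaluation, pair_toDual_twoSided]
  calc ‖pair (toDual f) (twoSided αᵀ x βᵀ)‖ ≤ mnorm f * (‖αᵀ‖ * mnorm x * ‖βᵀ‖) :=
        cbBound_mnorm f _ _ _
    _ = mnorm x * (‖α‖ * mnorm f * ‖β‖) := by
        rw [frobenius_norm_transpose, frobenius_norm_transpose]
        ring

theorem mnorm_le_of_forall_pair_toDual {x : Matrix k l X} {C : ℝ} (hC : 0 ≤ C)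
    (h : ∀ f : Matrix k l (StrongDual ℂ X), mnorm f ≤ 1 → ∀ (α : Matrix k k ℂ) (β : Matrix l l ℂ),
      ‖pair (toDual f) (twoSided α x β)‖ ≤ C * (‖α‖ * ‖β‖)) : mnorm x ≤ C := by
  refine mnorm_le_of_forall_pair hC fun g hg => ?_
  obtain ⟨f, rfl, hf⟩ := exists_toDual_eq zero_le_one hg
  exact h f hf

/-- The norm of `f` as a functional on `M_{k,l}(X)` is its trace class norm over `X*`, because a
factorization of the functional through a completely contractive `g` is one of `f` itself. -/
theorem norm_pair_le_one_of_forall_norm_pair_le_mnorm {f : Matrix k l (StrongDual ℂ X)}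
    (hf : ∀ x, ‖pair (toDual f) x‖ ≤ mnorm x) {H : Matrix k l (Module.Dual ℂ (StrongDual ℂ X))}
    (hH : CBBound H 1) : ‖pair H f‖ ≤ 1 := by
  refine le_of_forall_gt_imp_ge_of_dense fun C hC => ?_
  obtain ⟨g, a, b, hg, hab, hfac⟩ := exists_cb_factorization hf hC
  obtain ⟨g, rfl, hg⟩ := exists_toDual_eq zero_le_one hg
  have hfg : f = twoSided aᵀ g bᵀ := by
    refine toDual_injective (pair_injective (LinearMap.ext fun x => ?_))
    rw [hfac, pair_toDual_twoSided, transpose_transpose, transpose_transpose]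
  calc ‖pair H f‖ ≤ 1 * (‖aᵀ‖ * mnorm g * ‖bᵀ‖) := hfg ▸ hH _ _ _
    _ ≤ 1 * (‖aᵀ‖ * 1 * ‖bᵀ‖) := by gcongr
    _ = ‖a‖ * ‖b‖ := by simp [frobenius_norm_transpose]
    _ ≤ C := hab

theorem norm_pair_le_of_forall_norm_pair_le {f : Matrix k l (StrongDual ℂ X)} {K : ℝ} (hK : 0 ≤ K)
    (hf : ∀ x, ‖pair (toDual f) x‖ ≤ K * mnorm x)
    {H : Matrix k l (Module.Dual ℂ (StrongDual ℂ X))} (hH : CBBound H 1) : ‖pair H f‖ ≤ K := by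
  refine le_of_forall_gt_imp_ge_of_dense fun L hL => ?_
  have hL₀ := hK.trans_lt hL
  have hnorm (z : ℂ) : ‖(L⁻¹ : ℂ) • z‖ = L⁻¹ * ‖z‖ := by
    rw [norm_smul, norm_inv, Complex.norm_of_nonneg hL₀.le]
  have h : ‖pair H ((L⁻¹ : ℂ) • f)‖ ≤ 1 := by
    refine norm_pair_le_one_of_forall_norm_pair_le_mnorm (fun x => ?_) hH
    rw [← pair_evaluation, map_smul, pair_evaluation, hnorm, inv_mul_le_iff₀ hL₀]
    exact (hf x).trans (mul_le_mul_of_nonneg_right hL.le (mnorm_nonneg x))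
  rwa [map_smul, hnorm, inv_mul_le_iff₀ hL₀, mul_one] at h

end Bidual

section Adjoints

variable {X Y : Type*} [NormedAddCommGroup X] [NormedSpace ℂ X]
variable [NormedAddCommGroup Y] [NormedSpace ℂ Y]
variable {ι m n : Type}

/-- `T' s` is the adjoint of `T s` for every index `s`. -/
def AreAdjoint (T : ι → X →ₗ[ℂ] Y) (T' : ι → StrongDual ℂ Y →ₗ[ℂ] StrongDual ℂ X) : Prop :=
  ∀ s f x, T' s f x = f (T s x)

variable {T : ι → X →ₗ[ℂ] Y} {T' : ι → StrongDual ℂ Y →ₗ[ℂ] StrongDual ℂ X}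

theorem AreAdjoint.toDual_columnMap (h : AreAdjoint T T') (f : Matrix m n (StrongDual ℂ Y)) :
    toDual (columnMap T' f) = columnMap (fun s => (T s).dualMap) (toDual f) := by
  ext p j x
  exact h _ _ _

theorem AreAdjoint.toDual_columnSum [Fintype ι] (h : AreAdjoint T T')
    (f : Matrix (ι × m) n (StrongDual ℂ Y)) :
    toDual (columnSum T' f) = columnSum (fun s => (T s).dualMap) (toDual f) := by
  ext i j x
  simp [toDual, columnSum, h _ _ _]

variable [Fintype ι] [Fintype m] [Fintype n]

theorem AreAdjoint.pair_toDual_columnMap (h : AreAdjoint T T') (f : Matrix m n (StrongDual ℂ Y))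
    (x : Matrix (ι × m) n X) :
    pair (toDual (columnMap T' f)) x = pair (toDual f) (columnSum T x) := by
  rw [h.toDual_columnMap, pair_columnSum]

theorem AreAdjoint.pair_toDual_columnSum (h : AreAdjoint T T')
    (f : Matrix (ι × m) n (StrongDual ℂ Y)) (x : Matrix m n X) :
    pair (toDual (columnSum T' f)) x = pair (toDual f) (columnMap T x) := by
  rw [h.toDual_columnSum, pair_columnMap]

open scoped Matrix.Norms.Frobenius

variable [OperatorSpace X] [OperatorSpace Y]

theorem AreAdjoint.isColumnContraction_iff (h : AreAdjoint T T') :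
    IsColumnContraction T ↔ IsColumnContraction T' := by
  refine ⟨fun hT m n _ _ f => ?_, fun hT' m n _ _ x => ?_⟩
  · rw [mnorm_le_iff_cbBound (mnorm_nonneg f), h.toDual_columnMap]
    exact hT.cbBound_columnMap_dualMap (mnorm_nonneg f) (cbBound_mnorm f)
  · refine mnorm_le_of_forall_pair_toDual (mnorm_nonneg x) fun f hf α β => ?_
    obtain ⟨α, rfl⟩ := blockRow.surjective α
    have hx := mnorm_nonneg x
    rw [← columnSum_twoSided, ← h.pair_toDual_columnMap, norm_blockRow]
    calc _ ≤ mnorm (columnMap T' f) * (‖α‖ * mnorm x * ‖β‖) := cbBound_mnorm _ _ _ _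
      _ ≤ 1 * (‖α‖ * mnorm x * ‖β‖) := by
          gcongr
          exact (hT' f).trans hf
      _ = mnorm x * (‖α‖ * ‖β‖) := by ring

variable {r : ℕ} {T : Fin r → X →ₗ[ℂ] Y} {T' : Fin r → StrongDual ℂ Y →ₗ[ℂ] StrongDual ℂ X}

theorem AreAdjoint.isColumnSumContraction_iff (h : AreAdjoint T T') :
    IsColumnSumContraction T ↔ IsRowContraction T' := by
  refine ⟨fun hT m n _ _ f => ?_, fun hT' m n _ _ x => ?_⟩
  · have hf₀ := mnorm_nonneg f
    refine mnorm_le_of_forall_pair hf₀ fun g hg α β => ?_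
    rw [← map_twoSided, ← pair_coords_columnMap]
    refine norm_pair_le_of_forall_norm_pair_le (by positivity) (fun x => ?_)
      ((cbBound_coords_iff zero_le_one).2 hg)
    rw [h.pair_toDual_columnMap, pair_toDual_twoSided]
    calc _ ≤ mnorm f * (‖αᵀ‖ * mnorm (columnSum T x) * ‖βᵀ‖) := cbBound_mnorm f _ _ _
      _ ≤ mnorm f * (‖α‖ * mnorm x * ‖β‖) := by
          rw [frobenius_norm_transpose, frobenius_norm_transpose]
          gcongr
          exact hT x
      _ = mnorm f * (‖α‖ * ‖β‖) * mnorm x := by ring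
  · have hx₀ := mnorm_nonneg x
    refine mnorm_le_of_forall_pair_toDual hx₀ fun f hf α β => ?_
    obtain ⟨H, hH⟩ := exists_coords_eq (evaluation x)
    have hHx : CBBound H (mnorm x) :=
      (cbBound_coords_iff hx₀).1 (hH ▸ cbBound_evaluation x)
    have hpair : pair (toDual f) (twoSided α (columnSum T x) β) =
        pair H (twoSided αᵀ (f.map (rowMap T')) βᵀ) := by
      rw [← map_twoSided, ← pair_coords_columnMap, hH, pair_evaluation, h.pair_toDual_columnMap,
        pair_toDual_twoSided, transpose_transpose, transpose_transpose]
    calc ‖pair (toDual f) (twoSided α (columnSum T x) β)‖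
        ≤ mnorm x * (‖αᵀ‖ * mnorm (f.map (rowMap T')) * ‖βᵀ‖) := hpair ▸ hHx _ _ _
      _ ≤ mnorm x * (‖α‖ * 1 * ‖β‖) := by
          rw [frobenius_norm_transpose, frobenius_norm_transpose]
          gcongr
          exact (hT' f).trans hf
      _ = mnorm x * (‖α‖ * ‖β‖) := by ring

theorem AreAdjoint.isRowContraction_iff (h : AreAdjoint T T') :
    IsRowContraction T ↔ IsColumnSumContraction T' := by
  refine ⟨fun hT m n _ _ f => ?_, fun hT' m n _ _ x => ?_⟩
  · have hf₀ := mnorm_nonneg f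
    obtain ⟨H, hH⟩ := exists_coords_eq (toDual f)
    have hHf : CBBound H (mnorm f) := (cbBound_coords_iff hf₀).1 (hH ▸ cbBound_mnorm f)
    refine (mnorm_le_iff_cbBound hf₀).2 fun k l _ _ α x β => ?_
    rw [h.pair_toDual_columnSum, ← hH, pair_coords_columnMap, map_twoSided]
    refine (hHf _ _ _).trans ?_
    gcongr
    exact hT x
  · have hx₀ := mnorm_nonneg x
    refine mnorm_le_of_forall_pair hx₀ fun g hg α β => ?_
    obtain ⟨f, hf, hf₁⟩ := exists_toDual_eq zero_le_one ((cbBound_coords_iff zero_le_one).2 hg)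
    rw [← map_twoSided, ← pair_coords_columnMap, ← hf, ← h.pair_toDual_columnSum]
    calc _ ≤ mnorm (columnSum T' f) * (‖α‖ * mnorm x * ‖β‖) := cbBound_mnorm _ _ _ _
      _ ≤ 1 * (‖α‖ * mnorm x * ‖β‖) := by
          gcongr
          exact (hT' f).trans hf₁
      _ = mnorm x * (‖α‖ * ‖β‖) := by ring

end Adjoints

section Projections

variable {X : Type*} [NormedAddCommGroup X] [NormedSpace ℂ X]

theorem areAdjoint_splitting (P : X →L[ℂ] X) :
    AreAdjoint (splitting P) (splitting (adjointMap P)) := by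
  intro s f x
  fin_cases s
  · rfl
  · simp [splitting, adjointMap]

variable {P : X →ₗ[ℂ] X}

theorem adjointMap_comp_self (hP : P ∘ₗ P = P) (hc : Continuous P) :
    adjointMap ⟨P, hc⟩ ∘ₗ adjointMap ⟨P, hc⟩ = adjointMap ⟨P, hc⟩ := by
  ext f x
  exact congrArg f (LinearMap.congr_fun hP x)

variable [OperatorSpace X]

theorem IsColumnContraction.continuous_of_splitting (h : IsColumnContraction (splitting P)) :
    Continuous P := by
  refine (P.mkContinuous 1 fun x => ?_).continuous
  rw [one_mul, ← elemNorm_eq_norm, ← elemNorm_eq_norm]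
  exact (mnorm_submatrix_le (columnMap (splitting P) (of fun _ _ : Fin 1 => x))
    (Prod.mk_right_injective (0 : Fin 2)) Function.injective_id).trans (h _)

end Projections

end OpSp

end

theorem corollary3p5 {X : Type*} [NormedAddCommGroup X] [NormedSpace ℂ X] [OpSp.OperatorSpace X]
    (P : X →ₗ[ℂ] X) (hP : P ∘ₗ P = P) :
    (OpSp.IsCompleteLeftMProjection P ↔
      ∃ hc : Continuous P, OpSp.IsCompleteRightLProjection (OpSp.adjointMap ⟨P, hc⟩)) ∧
    (OpSp.IsCompleteRightLProjection P ↔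
      ∃ hc : Continuous P, OpSp.IsCompleteLeftMProjection (OpSp.adjointMap ⟨P, hc⟩)) := by
  have hP' := OpSp.adjointMap_comp_self hP
  have hadj (hc : Continuous P) := OpSp.areAdjoint_splitting ⟨P, hc⟩
  rw [OpSp.isCompleteLeftMProjection_iff, OpSp.isCompleteRightLProjection_iff]
  constructor
  · constructor
    · rintro ⟨-, hcol, hsum⟩
      have hc := hcol.continuous_of_splitting
      exact ⟨hc, OpSp.isCompleteRightLProjection_iff.2 ⟨hP' hc,
        (hadj hc).isColumnContraction_iff.1 hcol, (hadj hc).isColumnSumContraction_iff.1 hsum⟩⟩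
    · rintro ⟨hc, h⟩
      obtain ⟨-, hcol, hrow⟩ := OpSp.isCompleteRightLProjection_iff.1 h
      exact ⟨hP, (hadj hc).isColumnContraction_iff.2 hcol,
        (hadj hc).isColumnSumContraction_iff.2 hrow⟩
  · constructor
    · rintro ⟨-, hcol, hrow⟩
      have hc := hcol.continuous_of_splitting
      exact ⟨hc, OpSp.isCompleteLeftMProjection_iff.2 ⟨hP' hc,
        (hadj hc).isColumnContraction_iff.1 hcol, (hadj hc).isRowContraction_iff.1 hrow⟩⟩
    · rintro ⟨hc, h⟩
      obtain ⟨-, hcol, hsum⟩ := OpSp.isCompleteLeftMProjection_iff.1 h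
      exact ⟨hP, (hadj hc).isColumnContraction_iff.2 hcol, (hadj hc).isRowContraction_iff.2 hsum⟩
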